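/- A \emph{local measure} on $\mathbb R$ is a function $\mu:\{B\subseteq\mathbb R : B \text{ bounded Borel}\}\to\mathbb R$ such that $\mathbf 1_K\mu:=\mu(\cdot\cap K)$ is a signed Radon measure for every compact $K\subseteq\mathbb R$; $|\mu|$ denotes its total variation. Let $\mathcal M$ be the space of local measures with $\|\mu\|_{\mathrm{lu}}:=\sup_{a\in\mathbb R}|\mu|((a,a+1])<\infty$. For $\mu\in\mathcal M$ let $H_\mu$ be the maximal operator associated with $-\Delta+\mu$ in the complex space $L_2(\mathbb R)$, $$D(H_\mu)=\{u\in L_2(\mathbb R)\cap C(\mathbb R) : -u''+u\mu\in L_2(\mathbb R)\},\qquad H_\mu u=-u''+u\mu,$$ where $-u''+u\mu$ is understood in the sense of distributions. Let $\Omega\subseteq\mathcal M$ be $\|\cdot\|_{\mathrm{lu}}$-bounded, closed in $\mathcal M$ with respect to the vague topology (the topology generated by $\mu\mapsto\int\varphi\,d\mu$, $\varphi\in C_c(\mathbb R)$), and invariant under the translations $\alpha_t(\omega):=\omega(\cdot+t)$, $t\in\mathbb R$. Let $\mathbb P$ be an ergodic measure for $(\Omega,\alpha)$, that is, a Borel probability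 measure on $\Omega$ that is invariant under all $\alpha_t$ and such that every Borel set $A\subseteq\Omega$ with $\alpha_t^{-1}(A)=A$ for all $t\in\mathbb R$ satisfies $\mathbb P(A)\in\{0,1\}$. Assume condition (K): there is a sequence $(p_n)$ in $(0,\infty)$ with $p_n\to\infty$ such that the sets $$G_n:=\{\omega\in\Omega : \mathbf 1_{[0,p_n]}\omega=\mathbf 1_{[0,p_n]}\alpha_{p_n}(\omega)=\mathbf 1_{[0,p_n]}\alpha_{-p_n}(\omega)\}$$ satisfy $\limsup_{n\to\infty}\mathbb P(G_n)>0$. Then for $\mathbb P$-almost every $\omega\in\Omega$ the operator $H_\omega$ has no eigenvalues, i.e. $\sigma_{pp}(H_\omega)=\emptyset$. -/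

import Mathlib

open MeasureTheory Set Filter Topology
open scoped ENNReal CompactlySupported

/-- The bounded Borel subsets of `ℝ`. -/
abbrev BoundedBorel : Type := {B : Set ℝ // Bornology.IsBounded B ∧ MeasurableSet B}

/-- The intersection of a Borel set with a compact set. -/
def BoundedBorel.interCompact (A K : Set ℝ) (hA : MeasurableSet A) (hK : IsCompact K) :
    BoundedBorel :=
  ⟨A ∩ K, hK.isBounded.subset inter_subset_right, hA.inter hK.measurableSet⟩

/-- A local measure on `ℝ`: a real-valued function `μ` on the bounded Borel sets such that
`A ↦ μ (A ∩ K)` is a (finite) signed Borel measure for every compact `K`.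
(Every finite signed Borel measure on `ℝ` is Radon.) -/
@[ext]
structure LocalMeasure where
  toFun : BoundedBorel → ℝ
  exists_restrict : ∀ (K : Set ℝ) (hK : IsCompact K), ∃ s : SignedMeasure ℝ,
    ∀ (A : Set ℝ) (hA : MeasurableSet A), s A = toFun (BoundedBorel.interCompact A K hA hK)

namespace LocalMeasure

/-- The signed measure `1_[a,b] μ`. -/
noncomputable def restrictIcc (μ : LocalMeasure) (a b : ℝ) : SignedMeasure ℝ :=
  (μ.exists_restrict (Icc a b) isCompact_Icc).choose

theorem restrictIcc_apply (μ : LocalMeasure) (a b : ℝ) (A : Set ℝ) (hA : MeasurableSet A) :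
    μ.restrictIcc a b A = μ.toFun (BoundedBorel.interCompact A (Icc a b) hA isCompact_Icc) :=
  (μ.exists_restrict (Icc a b) isCompact_Icc).choose_spec A hA

/-- The positive part of `μ`, a Radon measure on `ℝ`, glued from the positive parts of the
restrictions of `μ` to the disjoint intervals `(n, n + 1]`. -/
noncomputable def posPart (μ : LocalMeasure) : Measure ℝ :=
  Measure.sum fun n : ℤ =>
    (μ.restrictIcc n (n + 1)).toJordanDecomposition.posPart.restrict (Ioc (n : ℝ) (n + 1))

/-- The negative part of `μ`. -/
noncomputable def negPart (μ : LocalMeasure) : Measure ℝ :=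
  Measure.sum fun n : ℤ =>
    (μ.restrictIcc n (n + 1)).toJordanDecomposition.negPart.restrict (Ioc (n : ℝ) (n + 1))

/-- The total variation `|μ|`, a nonnegative Radon measure on `ℝ`. -/
noncomputable def variation (μ : LocalMeasure) : Measure ℝ := μ.posPart + μ.negPart

theorem isFiniteMeasureOnCompacts_sum (m : ℤ → Measure ℝ) [∀ n, IsFiniteMeasure (m n)] :
    IsFiniteMeasureOnCompacts
      (Measure.sum fun n : ℤ => (m n).restrict (Ioc (n : ℝ) (n + 1))) := by
  constructor
  intro K hK
  obtain ⟨R, hR⟩ := hK.isBounded.subset_closedBall 0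
  have hsub : K ⊆ Icc (-R) R := by
    rw [Real.closedBall_eq_Icc] at hR
    simpa using hR
  rw [Measure.sum_apply _ hK.measurableSet, tsum_eq_sum (s := Finset.Icc (⌊-R⌋ - 1) ⌈R⌉)]
  · exact ENNReal.sum_lt_top.2 fun n _ => measure_lt_top _ _
  · intro n hn
    rw [Measure.restrict_apply hK.measurableSet]
    have : K ∩ Ioc (n : ℝ) (n + 1) = ∅ := by
      ext x
      simp only [mem_inter_iff, mem_Ioc, mem_empty_iff_false, iff_false, not_and]
      intro hx hnx hxn
      have hx' := hsub hx
      apply hn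
      rw [Finset.mem_Icc]
      constructor
      · have h1 : (⌊-R⌋ : ℝ) ≤ -R := Int.floor_le _
        have : (⌊-R⌋ : ℝ) ≤ ((n + 1 : ℤ) : ℝ) := by
          push_cast
          linarith [hx'.1]
        have := Int.cast_le.1 this
        linarith
      · have h1 : R ≤ (⌈R⌉ : ℝ) := Int.le_ceil _
        have : (n : ℝ) ≤ (⌈R⌉ : ℝ) := by linarith [hx'.2]
        exact Int.cast_le.1 this
    rw [this, measure_empty]

instance (μ : LocalMeasure) : IsFiniteMeasureOnCompacts μ.posPart :=
  isFiniteMeasureOnCompacts_sum _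

instance (μ : LocalMeasure) : IsFiniteMeasureOnCompacts μ.negPart :=
  isFiniteMeasureOnCompacts_sum _

/-- The integral `∫ f dμ`; it is used only for continuous `f` with compact support. -/
noncomputable def integral {E : Type*} [NormedAddCommGroup E] [NormedSpace ℝ E]
    (μ : LocalMeasure) (f : ℝ → E) : E :=
  ∫ x, f x ∂μ.posPart - ∫ x, f x ∂μ.negPart

/-- `‖μ‖_lu = sup_{a ∈ ℝ} |μ|((a, a + 1])`, with values in `[0, ∞]`. -/
noncomputable def luNorm (μ : LocalMeasure) : ℝ≥0∞ :=
  ⨆ a : ℝ, μ.variation (Ioc a (a + 1))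

/-- The space of uniformly locally bounded local measures. -/
def uniformlyLocallyBounded : Set LocalMeasure := {μ | μ.luNorm < ∞}

/-- The vague topology: the coarsest one that makes `μ ↦ ∫ φ dμ` continuous for each continuous
compactly supported `φ : ℝ → ℝ`. -/
noncomputable instance vagueTopology : TopologicalSpace LocalMeasure :=
  TopologicalSpace.induced (fun (μ : LocalMeasure) (φ : C_c(ℝ, ℝ)) => μ.integral φ) inferInstance

/-- The Borel σ-algebra of the vague topology. -/
noncomputable instance : MeasurableSpace LocalMeasure := borel LocalMeasure

instance : BorelSpace LocalMeasure := ⟨rfl⟩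

/-- The translated set `B + t`. -/
def _root_.BoundedBorel.translate (t : ℝ) (B : BoundedBorel) : BoundedBorel :=
  ⟨(fun x => x - t) ⁻¹' B.1, by
    have h : (fun x : ℝ => x - t) ⁻¹' B.1 = (fun x => x + t) '' B.1 := by
      ext x
      simp [sub_eq_add_neg]
    rw [h]
    exact (LipschitzWith.of_edist_le (f := fun x : ℝ => x + t)
      (fun x y => by simp)).isBounded_image B.2.1,
    (measurable_id.sub_const t) B.2.2⟩

/-- The translation `α_t μ = μ(· + t)`, that is `(α_t μ)(B) = μ(B + t)`. -/
def translate (t : ℝ) (μ : LocalMeasure) : LocalMeasure where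
  toFun B := μ.toFun (B.translate t)
  exists_restrict K hK := by
    have hK' : IsCompact ((fun x : ℝ => x - t) ⁻¹' K) := by
      have h : (fun x : ℝ => x - t) ⁻¹' K = (fun x => x + t) '' K := by
        ext x
        simp [sub_eq_add_neg]
      rw [h]
      exact hK.image (continuous_add_const t)
    obtain ⟨s, hs⟩ := μ.exists_restrict _ hK'
    have hm : Measurable fun x : ℝ => x - t := measurable_id.sub_const t
    refine ⟨s.map fun x => x - t, fun A hA => ?_⟩
    rw [VectorMeasure.map_apply _ hm hA, hs _ (hm hA)]
    rfl

/-- The distributional identity `-u'' + u μ = f` on `ℝ`, for continuous `u` and locally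
integrable `f`. -/
def WeakEquation (μ : LocalMeasure) (u f : ℝ → ℂ) : Prop :=
  ∀ φ : ℝ → ℂ, ContDiff ℝ ((⊤ : ℕ∞) : WithTop ℕ∞) φ → HasCompactSupport φ →
    -(∫ x, u x * iteratedDeriv 2 φ x) + μ.integral (fun x => u x * φ x) = ∫ x, f x * φ x

/-- The graph of `H_μ`: the pairs `(u, f)` in `L²(ℝ) × L²(ℝ)` such that `u` has a continuous
representative `v` with `-v'' + v μ = f` in the sense of distributions. -/
noncomputable def schrodingerGraph (μ : LocalMeasure) :
    Submodule ℂ (Lp ℂ 2 (volume : Measure ℝ) × Lp ℂ 2 (volume : Measure ℝ)) where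
  carrier := {p | ∃ v : ℝ → ℂ, Continuous v ∧ p.1 =ᵐ[volume] v ∧ μ.WeakEquation v p.2}
  zero_mem' := by
    refine ⟨0, continuous_zero, Lp.coeFn_zero _ _ _, fun φ _ _ => ?_⟩
    have h : ∫ x, (((0 : Lp ℂ 2 (volume : Measure ℝ)) : ℝ → ℂ) x) * φ x = 0 := by
      rw [← integral_zero ℝ ℂ]
      refine integral_congr_ae ?_
      filter_upwards [Lp.coeFn_zero ℂ 2 (volume : Measure ℝ)] with x hx
      rw [hx, Pi.zero_apply, zero_mul]
    change _ = ∫ x, (((0 : Lp ℂ 2 (volume : Measure ℝ)) : ℝ → ℂ) x) * φ x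
    rw [h]
    simp [LocalMeasure.integral]
  add_mem' := by
    rintro ⟨u₁, f₁⟩ ⟨u₂, f₂⟩ ⟨v₁, hc₁, he₁, hw₁⟩ ⟨v₂, hc₂, he₂, hw₂⟩
    refine ⟨v₁ + v₂, hc₁.add hc₂, (Lp.coeFn_add _ _).trans (he₁.add he₂), fun φ hφ hs => ?_⟩
    have hL : ∀ f : Lp ℂ 2 (volume : Measure ℝ), Integrable (fun x => f x * φ x) := by
      intro f
      have h2 : MemLp φ 2 (volume : Measure ℝ) := hφ.continuous.memLp_of_hasCompactSupport hs
      exact (Lp.memLp f).integrable_mul h2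
    have hv : ∀ v : ℝ → ℂ, Continuous v → ∀ ψ : ℝ → ℂ, Continuous ψ → HasCompactSupport ψ →
        ∀ m : Measure ℝ, IsFiniteMeasureOnCompacts m → Integrable (fun x => v x * ψ x) m := by
      intro v hv ψ hψ hψs m hm
      exact (hv.mul hψ).integrable_of_hasCompactSupport hψs.mul_left
    have hd : Continuous (iteratedDeriv 2 φ) := (contDiff_infty.1 hφ 2).continuous_iteratedDeriv 2 (by simp)
    have hds : HasCompactSupport (iteratedDeriv 2 φ) := by
      rw [iteratedDeriv_succ, iteratedDeriv_one]
      exact hs.deriv.deriv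
    have h1 := hw₁ φ hφ hs
    have h2 := hw₂ φ hφ hs
    have h3 : ∫ x, ((f₁ + f₂ : Lp ℂ 2 (volume : Measure ℝ)) : ℝ → ℂ) x * φ x
        = (∫ x, f₁ x * φ x) + ∫ x, f₂ x * φ x := by
      rw [← integral_add (hL f₁) (hL f₂)]
      refine integral_congr_ae ?_
      filter_upwards [Lp.coeFn_add f₁ f₂] with x hx
      rw [hx, Pi.add_apply, add_mul]
    change _ = ∫ x, ((f₁ + f₂ : Lp ℂ 2 (volume : Measure ℝ)) : ℝ → ℂ) x * φ x
    rw [h3]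
    simp only [LocalMeasure.integral, Pi.add_apply, add_mul] at h1 h2 ⊢
    rw [integral_add (hv v₁ hc₁ _ hd hds _ inferInstance) (hv v₂ hc₂ _ hd hds _ inferInstance),
      integral_add (hv v₁ hc₁ _ hφ.continuous hs μ.posPart inferInstance)
        (hv v₂ hc₂ _ hφ.continuous hs μ.posPart inferInstance),
      integral_add (hv v₁ hc₁ _ hφ.continuous hs μ.negPart inferInstance)
        (hv v₂ hc₂ _ hφ.continuous hs μ.negPart inferInstance), ← h1, ← h2]
    ring
  smul_mem' := by
    rintro c ⟨u, f⟩ ⟨v, hc, he, hw⟩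
    refine ⟨c • v, hc.const_smul c, (Lp.coeFn_smul _ _).trans (he.const_smul c), fun φ hφ hs => ?_⟩
    have h1 := hw φ hφ hs
    have h3 : ∫ x, ((c • f : Lp ℂ 2 (volume : Measure ℝ)) : ℝ → ℂ) x * φ x
        = c * ∫ x, f x * φ x := by
      rw [← integral_const_mul]
      refine integral_congr_ae ?_
      filter_upwards [Lp.coeFn_smul c f] with x hx
      rw [hx, Pi.smul_apply, smul_eq_mul, mul_assoc]
    change _ = ∫ x, ((c • f : Lp ℂ 2 (volume : Measure ℝ)) : ℝ → ℂ) x * φ x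
    rw [h3]
    simp only [LocalMeasure.integral, Pi.smul_apply, smul_eq_mul, mul_assoc] at h1 ⊢
    rw [integral_const_mul, integral_const_mul, integral_const_mul, ← h1]
    ring

/-- `schrodingerGraph μ` is the graph of an operator. -/
theorem schrodingerGraph_singleValued (μ : LocalMeasure)
    (p : Lp ℂ 2 (volume : Measure ℝ) × Lp ℂ 2 (volume : Measure ℝ))
    (hp : p ∈ μ.schrodingerGraph) (h0 : p.1 = 0) : p.2 = 0 := by
  obtain ⟨v, hc, he, hw⟩ := hp
  have hv : v = 0 := by
    have h : v =ᵐ[volume] (0 : ℝ → ℂ) := by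
      rw [h0] at he
      exact he.symm.trans (Lp.coeFn_zero _ _ _)
    exact (hc.ae_eq_iff_eq volume continuous_zero).1 h
  subst hv
  rw [Lp.eq_zero_iff_ae_eq_zero]
  refine ae_eq_zero_of_integral_contDiff_smul_eq_zero
    ((Lp.memLp p.2).locallyIntegrable (by norm_num)) fun g hg hgs => ?_
  have h := hw (fun x => (g x : ℂ)) (Complex.ofRealCLM.contDiff.comp hg)
    (hgs.comp_left (g := fun y : ℝ => (y : ℂ)) Complex.ofReal_zero)
  simp only [LocalMeasure.integral, Pi.zero_apply, zero_mul, integral_zero, sub_self, neg_zero,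
    add_zero] at h
  rw [h]
  refine integral_congr_ae (Eventually.of_forall fun x => ?_)
  simp [mul_comm]

/-- The Schrödinger operator `H_μ = -Δ + μ` in `L²(ℝ)`: the maximal operator, with domain
`{u ∈ L²(ℝ) ∩ C(ℝ) : -u'' + u μ ∈ L²(ℝ)}` and `H_μ u = -u'' + u μ`. -/
noncomputable def schrodinger (μ : LocalMeasure) :
    Lp ℂ 2 (volume : Measure ℝ) →ₗ.[ℂ] Lp ℂ 2 (volume : Measure ℝ) :=
  μ.schrodingerGraph.toLinearPMap

theorem schrodinger_graph (μ : LocalMeasure) : μ.schrodinger.graph = μ.schrodingerGraph :=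
  Submodule.toLinearPMap_graph_eq _ fun p hp h0 => μ.schrodingerGraph_singleValued p hp h0

end LocalMeasure

/-- The set of eigenvalues of a partially defined linear operator. -/
def LinearPMap.pointSpectrum {E : Type*} [AddCommGroup E] [Module ℂ E] (H : E →ₗ.[ℂ] E) : Set ℂ :=
  {z | ∃ u : H.domain, u ≠ 0 ∧ H u = z • (u : E)}

/-- A set `Ω` of local measures on which the potentials live: bounded with respect to `‖·‖_lu`,
closed with respect to the vague topology in the space of uniformly locally bounded local
measures, and invariant under translations. -/
structure IsPotentialSpace (Ω : Set LocalMeasure) : Prop where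
  subset : Ω ⊆ LocalMeasure.uniformlyLocallyBounded
  bounded : ∃ C : ℝ≥0∞, C < ∞ ∧ ∀ ω ∈ Ω, ω.luNorm ≤ C
  closed : IsClosed ((↑) ⁻¹' Ω : Set LocalMeasure.uniformlyLocallyBounded)
  translate_mem : ∀ t : ℝ, MapsTo (LocalMeasure.translate t) Ω Ω

namespace IsPotentialSpace

/-- The action `α_t` of `t ∈ ℝ` on `Ω`. -/
def shift {Ω : Set LocalMeasure} (hΩ : IsPotentialSpace Ω) (t : ℝ) : Ω → Ω :=
  (hΩ.translate_mem t).restrict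

/-- `P` is an ergodic measure for `(Ω, α)`: an `α`-invariant Borel probability measure for which
every `α`-invariant Borel set has measure `0` or `1`. -/
structure IsErgodic {Ω : Set LocalMeasure} (hΩ : IsPotentialSpace Ω) (P : Measure Ω) : Prop where
  isProbabilityMeasure : IsProbabilityMeasure P
  measurePreserving : ∀ t : ℝ, MeasurePreserving (hΩ.shift t) P P
  zero_one : ∀ A : Set Ω, MeasurableSet A → (∀ t : ℝ, hΩ.shift t ⁻¹' A = A) → P A = 0 ∨ P A = 1

/-- The set of `ω ∈ Ω` with `1_[0,p] ω = 1_[0,p] α_p ω = 1_[0,p] α_{-p} ω`. -/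
def gordonSet {Ω : Set LocalMeasure} (hΩ : IsPotentialSpace Ω) (p : ℝ) : Set Ω :=
  {ω | ω.1.restrictIcc 0 p = (hΩ.shift p ω).1.restrictIcc 0 p ∧
    (hΩ.shift p ω).1.restrictIcc 0 p = (hΩ.shift (-p) ω).1.restrictIcc 0 p}

/-- Condition (K). -/
def ConditionK {Ω : Set LocalMeasure} (hΩ : IsPotentialSpace Ω) (P : Measure Ω) : Prop :=
  ∃ p : ℕ → ℝ, (∀ n, 0 < p n) ∧ Tendsto p atTop atTop ∧
    0 < limsup (fun n => P (hΩ.gordonSet (p n))) atTop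

end IsPotentialSpace

/-!
The proof is Gordon's argument. With respect to a measure `m` dominating `μ` and the Lebesgue
measure, `-u'' + u μ = z u` becomes an equation `du' = g u dm`, whose solutions are determined by
their Cauchy data and whose Wronskians are constant. If `μ` repeats itself three times with period
`p` around the origin, then up to boundary terms `u` and its translate by `p` solve the same
equation on an interval of length `2 p`. If their Wronskian vanishes, then `u (x + p) = l * u x`
there; otherwise the translates by `0`, `p` and `2 p` satisfy a recurrence
`u (x + 2 * p) + u x = β * u (x + p)` on an interval of length `p`, which is the Cayley-Hamilton
theorem for the transfer matrix over a period. Distinguishing whether the coefficient is small or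
large, one bounds `u` near the origin by its values at two points at distance at least of order `p`.
As the mass of a square integrable `u` on unit intervals tends to `0` at infinity, `u` vanishes if
`μ` repeats itself for arbitrarily large `p`.

By (K) this happens for infinitely many `p n` with positive probability. Up to boundary terms of
bounded length, the local measures with this property form a translation invariant set, which is
Borel because agreement with a translate on an open interval is a vaguely closed condition; by
ergodicity it has full probability.
-/

section IntegrationByParts

variable {𝕜 E : Type*} [RCLike 𝕜] [NormedAddCommGroup E] [NormedSpace 𝕜 E]
  {m : Measure ℝ} {a b : ℝ} {f : ℝ → 𝕜} {h : ℝ → E}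

theorem integrable_indicator_lt_smul (hf : IntegrableOn f (Ioc a b))
    (hh : IntegrableOn h (Ioc a b) m) :
    Integrable ({z : ℝ × ℝ | z.1 < z.2}.indicator fun z => f z.1 • h z.2)
      ((volume.restrict (Ioc a b)).prod (m.restrict (Ioc a b))) :=
  (Integrable.smul_prod hf hh).indicator (measurableSet_lt measurable_fst measurable_snd)

variable [NormedSpace ℝ E]

theorem setIntegral_indicator_lt_smul_right [SMulCommClass ℝ 𝕜 E] {y : ℝ} (hy : y ∈ Ioc a b) :
    ∫ x in Ioc a b, {z : ℝ × ℝ | z.1 < z.2}.indicator (fun z => f z.1 • h z.2) (y, x) ∂m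
      = f y • ∫ x in y..b, h x ∂m := by
  have hsection : ∀ x, {z : ℝ × ℝ | z.1 < z.2}.indicator (fun z => f z.1 • h z.2) (y, x)
      = (Ioi y).indicator (fun x => f y • h x) x := fun _ => rfl
  have hinter : Ioc a b ∩ Ioi y = Ioc y b := by
    rw [Ioc_inter_Ioi, max_eq_right hy.1.le]
  simp_rw [hsection]
  rw [setIntegral_indicator measurableSet_Ioi, hinter, integral_smul,
    intervalIntegral.integral_of_le hy.2]

theorem setIntegral_indicator_lt_smul_left [CompleteSpace E] {x : ℝ}
    (hx : x ∈ Ioc a b) :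
    ∫ y in Ioc a b, {z : ℝ × ℝ | z.1 < z.2}.indicator (fun z => f z.1 • h z.2) (y, x)
      = (∫ y in a..x, f y) • h x := by
  have hsection : ∀ y, {z : ℝ × ℝ | z.1 < z.2}.indicator (fun z => f z.1 • h z.2) (y, x)
      = (Iio x).indicator (fun y => f y • h x) y := fun _ => rfl
  have hinter : Ioc a b ∩ Iio x = Ioo a x := by
    ext y
    exact ⟨fun hy => ⟨hy.1.1, hy.2⟩, fun hy => ⟨⟨hy.1, hy.2.le.trans hx.2⟩, hy.2⟩⟩
  simp_rw [hsection]
  rw [setIntegral_indicator measurableSet_Iio, hinter, integral_smul_const,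
    intervalIntegral.integral_of_le hx.1.le, integral_Ioc_eq_integral_Ioo]

theorem intervalIntegrable_smul_integral_right [SMulCommClass ℝ 𝕜 E] [SFinite m] (hab : a ≤ b)
    (hf : IntervalIntegrable f volume a b) (hh : IntervalIntegrable h m a b) :
    IntervalIntegrable (fun y => f y • ∫ x in y..b, h x ∂m) volume a b := by
  rw [intervalIntegrable_iff_integrableOn_Ioc_of_le hab] at hf hh ⊢
  exact (integrable_indicator_lt_smul hf hh).integral_prod_left.congr <|
    (ae_restrict_mem measurableSet_Ioc).mono fun _ => setIntegral_indicator_lt_smul_right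

theorem intervalIntegrable_integral_left_smul [CompleteSpace E] [SFinite m] (hab : a ≤ b)
    (hf : IntervalIntegrable f volume a b) (hh : IntervalIntegrable h m a b) :
    IntervalIntegrable (fun x => (∫ y in a..x, f y) • h x) m a b := by
  rw [intervalIntegrable_iff_integrableOn_Ioc_of_le hab] at hf hh ⊢
  exact (integrable_indicator_lt_smul hf hh).integral_prod_right.congr <|
    (ae_restrict_mem measurableSet_Ioc).mono fun _ => setIntegral_indicator_lt_smul_left

theorem integral_integral_left_smul [SMulCommClass ℝ 𝕜 E] [CompleteSpace E] [SFinite m]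
    (hab : a ≤ b) (hf : IntervalIntegrable f volume a b) (hh : IntervalIntegrable h m a b) :
    ∫ x in a..b, (∫ y in a..x, f y) • h x ∂m = ∫ y in a..b, f y • ∫ x in y..b, h x ∂m := by
  rw [intervalIntegrable_iff_integrableOn_Ioc_of_le hab] at hf hh
  rw [intervalIntegral.integral_of_le hab, intervalIntegral.integral_of_le hab,
    ← setIntegral_congr_fun measurableSet_Ioc fun _ => setIntegral_indicator_lt_smul_left,
    ← setIntegral_congr_fun measurableSet_Ioc fun _ => setIntegral_indicator_lt_smul_right]
  exact (integral_integral_swap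
    (f := fun y x => {z : ℝ × ℝ | z.1 < z.2}.indicator (fun z => f z.1 • h z.2) (y, x))
    (integrable_indicator_lt_smul hf hh)).symm

theorem integral_smul_add_integral_smul_eq_sub [SMulCommClass ℝ 𝕜 E] [CompleteSpace E] [SFinite m]
    {U : ℝ → 𝕜} {V : ℝ → E} (hab : a ≤ b)
    (hf : IntervalIntegrable f volume a b) (hh : IntervalIntegrable h m a b)
    (hU : ∀ x ∈ Icc a b, U x - U a = ∫ y in a..x, f y)
    (hV : ∀ x ∈ Icc a b, V b - V x = ∫ y in x..b, h y ∂m) :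
    (∫ x in a..b, U x • h x ∂m) + ∫ x in a..b, f x • V x = U b • V b - U a • V a := by
  have hUh : ∫ x in a..b, U x • h x ∂m
      = (∫ x in a..b, (∫ y in a..x, f y) • h x ∂m) + U a • ∫ x in a..b, h x ∂m := by
    rw [← intervalIntegral.integral_smul]
    refine Eq.trans ?_ (intervalIntegral.integral_add
      (intervalIntegrable_integral_left_smul hab hf hh) (hh.smul (U a)))
    refine intervalIntegral.integral_congr fun x hx => ?_
    rw [uIcc_of_le hab] at hx
    simp only [← hU x hx, ← add_smul, sub_add_cancel]
  have hfV : ∫ x in a..b, f x • V x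
      = (∫ x in a..b, f x) • V b - ∫ x in a..b, f x • ∫ y in x..b, h y ∂m := by
    have hfVb : IntervalIntegrable (fun x => f x • V b) volume a b :=
      ⟨hf.1.smul_const _, hf.2.smul_const _⟩
    rw [← intervalIntegral.integral_smul_const, ← intervalIntegral.integral_sub hfVb
      (intervalIntegrable_smul_integral_right hab hf hh)]
    refine intervalIntegral.integral_congr fun x hx => ?_
    rw [uIcc_of_le hab] at hx
    simp only [← hV x hx, ← smul_sub, sub_sub_cancel]
  rw [hUh, hfV, integral_integral_left_smul hab hf hh, ← hU b (right_mem_Icc.2 hab),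
    ← hV a (left_mem_Icc.2 hab)]
  module

end IntegrationByParts

theorem intervalIntegrable_of_locallyIntegrable {E : Type*} [NormedAddCommGroup E] {m : Measure ℝ}
    {f : ℝ → E} (hf : LocallyIntegrable f m) (a b : ℝ) : IntervalIntegrable f m a b :=
  (hf.integrableOn_isCompact isCompact_uIcc).intervalIntegrable

section Gronwall

variable {E : Type*} [NormedAddCommGroup E] {w : ℝ → E} {K a b : ℝ}

theorem eq_zero_of_norm_le_mul_integral_norm (hw : ∀ s t, IntervalIntegrable w volume s t)
    (hle : ∀ x ∈ Icc a b, ‖w x‖ ≤ K * ∫ y in a..x, ‖w y‖) : ∀ x ∈ Icc a b, w x = 0 := by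
  set W : ℝ → ℝ := fun x => ∫ y in a..x, ‖w y‖
  have hW : Continuous W := intervalIntegral.continuous_primitive (fun s t => (hw s t).norm) a
  have hW_nonneg : ∀ x ∈ Icc a b, 0 ≤ W x := fun x hx =>
    intervalIntegral.integral_nonneg hx.1 fun _ _ => norm_nonneg _
  have hW_le : ∀ x ∈ Icc a b, W x ≤ K * ∫ t in a..x, W t := fun x hx => by
    rw [← intervalIntegral.integral_const_mul]
    exact intervalIntegral.integral_mono_on hx.1 (hw a x).norm
      ((hW.const_mul K).intervalIntegrable a x) fun y hy => hle y ⟨hy.1, hy.2.trans hx.2⟩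
  have hderiv : ∀ x, HasDerivAt (fun x => ∫ t in a..x, W t) (W x) x := fun x =>
    (hW.integral_hasStrictDerivAt a x).hasDerivAt
  have hprimitive : ∀ x ∈ Icc a b, ∫ t in a..x, W t = 0 := by
    refine eq_zero_of_abs_deriv_le_mul_abs_self_of_eq_zero_right (K := K)
      (fun x _ => (hderiv x).continuousAt.continuousWithinAt)
      (fun x _ => (hderiv x).hasDerivWithinAt) intervalIntegral.integral_same fun x hx => ?_
    have hx := Ico_subset_Icc_self hx
    rw [Real.norm_of_nonneg (hW_nonneg x hx), Real.norm_of_nonneg]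
    · exact hW_le x hx
    · exact intervalIntegral.integral_nonneg hx.1 fun t ht => hW_nonneg t ⟨ht.1, ht.2.trans hx.2⟩
  intro x hx
  have hWx : W x = 0 :=
    ((hW_le x hx).trans_eq (by rw [hprimitive x hx, mul_zero])).antisymm (hW_nonneg x hx)
  exact norm_le_zero_iff.1 ((hle x hx).trans_eq (mul_eq_zero_of_right K hWx))

theorem eq_zero_of_norm_le_mul_abs_integral_norm (hw : ∀ s t, IntervalIntegrable w volume s t)
    (hle : ∀ x ∈ uIcc a b, ‖w x‖ ≤ K * |∫ y in a..x, ‖w y‖|) : ∀ x ∈ uIcc a b, w x = 0 := by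
  rcases le_total a b with hab | hba
  · rw [uIcc_of_le hab] at hle ⊢
    refine eq_zero_of_norm_le_mul_integral_norm (K := K) hw fun x hx => ?_
    rw [← abs_of_nonneg (intervalIntegral.integral_nonneg hx.1 fun _ _ => norm_nonneg _)]
    exact hle x hx
  · rw [uIcc_of_ge hba] at hle ⊢
    have hreflected : ∀ x ∈ Icc (-a) (-b), w (-x) = 0 := by
      refine eq_zero_of_norm_le_mul_integral_norm (K := K) (w := fun x => w (-x))
        (fun s t => by
          simpa using (IntervalIntegrable.iff_comp_neg (by simp)).1 (hw (-s) (-t))) fun x hx => ?_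
      have hx' : -x ∈ Icc b a := ⟨le_neg_of_le_neg hx.2, neg_le.1 hx.1⟩
      rw [intervalIntegral.integral_comp_neg fun y => ‖w y‖, neg_neg,
        ← abs_of_nonneg (intervalIntegral.integral_nonneg hx'.2 fun _ _ => norm_nonneg _),
        intervalIntegral.integral_symm, abs_neg]
      exact hle (-x) hx'
    intro x hx
    simpa using hreflected (-x) ⟨neg_le_neg hx.2, neg_le_neg hx.1⟩

end Gronwall

section QuasiSolution

variable {𝕜 : Type*} [RCLike 𝕜]

/-- `w` is a version of `u'`, and `u'' = g u m` as measures on the order-connected set `S`. The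
derivative of a solution of `-u'' + u μ = z u` jumps at the atoms of `μ`, so that the pointwise
values of `w` are part of the data; they are normalized to be right continuous. -/
structure IsQuasiSolutionOn (m : Measure ℝ) (g : ℝ → 𝕜) (S : Set ℝ) (u w : ℝ → 𝕜) : Prop where
  intervalIntegrable : ∀ s t, IntervalIntegrable w volume s t
  sub_eq : ∀ s t, u t - u s = ∫ x in s..t, w x
  deriv_sub_eq : ∀ s ∈ S, ∀ t ∈ S, w t - w s = ∫ x in s..t, g x * u x ∂m

/-- The measure `g m` and its translate by `p` coincide on the half-open intervals with endpoints
in `S`, expressed through integrals of continuous functions. -/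
def HasPeriodOn (m : Measure ℝ) (g : ℝ → 𝕜) (p : ℝ) (S : Set ℝ) : Prop :=
  ∀ f : ℝ → 𝕜, Continuous f → ∀ s ∈ S, ∀ t ∈ S,
    ∫ x in s..t, g x * f (x + p) ∂m = ∫ x in (s + p)..(t + p), g x * f x ∂m

theorem HasPeriodOn.mono {m : Measure ℝ} {g : ℝ → 𝕜} {p : ℝ} {S T : Set ℝ}
    (h : HasPeriodOn m g p T) (hST : S ⊆ T) : HasPeriodOn m g p S :=
  fun f hf s hs t ht => h f hf s (hST hs) t (hST ht)

namespace IsQuasiSolutionOn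

variable {m : Measure ℝ} {g u w u' w' : ℝ → 𝕜} {S T : Set ℝ} {s t : ℝ}

theorem continuous (h : IsQuasiSolutionOn m g S u w) : Continuous u := by
  have hu : u = fun t => u 0 + ∫ x in (0 : ℝ)..t, w x := by
    funext t
    rw [← h.sub_eq, add_sub_cancel]
  rw [hu]
  exact continuous_const.add (intervalIntegral.continuous_primitive h.intervalIntegrable 0)

theorem mono (h : IsQuasiSolutionOn m g T u w) (hST : S ⊆ T) : IsQuasiSolutionOn m g S u w where
  intervalIntegrable := h.intervalIntegrable
  sub_eq := h.sub_eq
  deriv_sub_eq s hs t ht := h.deriv_sub_eq s (hST hs) t (hST ht)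

theorem comp_add_right (h : IsQuasiSolutionOn m g T u w) {p : ℝ} (hp : HasPeriodOn m g p S)
    (hST : MapsTo (· + p) S T) :
    IsQuasiSolutionOn m g S (fun x => u (x + p)) (fun x => w (x + p)) where
  intervalIntegrable s t := by simpa using (h.intervalIntegrable (s + p) (t + p)).comp_add_right p
  sub_eq s t := by rw [h.sub_eq, intervalIntegral.integral_comp_add_right]
  deriv_sub_eq s hs t ht := by
    rw [h.deriv_sub_eq _ (hST hs) _ (hST ht), hp u h.continuous s hs t ht]

theorem intervalIntegrable_mul (hg : LocallyIntegrable g m)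
    (h : IsQuasiSolutionOn m g S u w) (s t : ℝ) : IntervalIntegrable (fun x => g x * u x) m s t :=
  intervalIntegrable_of_locallyIntegrable (hg.mul_continuous h.continuous) s t

theorem sub_const_mul (hg : LocallyIntegrable g m)
    (h : IsQuasiSolutionOn m g S u w) (h' : IsQuasiSolutionOn m g S u' w') (k : 𝕜) :
    IsQuasiSolutionOn m g S (fun x => u x - k * u' x) (fun x => w x - k * w' x) where
  intervalIntegrable s t := (h.intervalIntegrable s t).sub ((h'.intervalIntegrable s t).const_mul k)
  sub_eq s t := by
    rw [intervalIntegral.integral_sub (h.intervalIntegrable s t)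
      ((h'.intervalIntegrable s t).const_mul k), intervalIntegral.integral_const_mul,
      ← h.sub_eq, ← h'.sub_eq]
    ring
  deriv_sub_eq s hs t ht := by
    simp_rw [mul_sub, mul_left_comm _ k]
    rw [intervalIntegral.integral_sub (h.intervalIntegrable_mul hg s t)
      ((h'.intervalIntegrable_mul hg s t).const_mul k), intervalIntegral.integral_const_mul,
      ← h.deriv_sub_eq s hs t ht, ← h'.deriv_sub_eq s hs t ht]
    ring

theorem integral_add_integral_eq_sub [IsLocallyFiniteMeasure m] (hg : LocallyIntegrable g m)
    (h : IsQuasiSolutionOn m g S u w) (h' : IsQuasiSolutionOn m g (Icc s t) u' w') (hst : s ≤ t) :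
    (∫ x in s..t, g x * (u x * u' x) ∂m) + ∫ x in s..t, w x * w' x
      = u t * w' t - u s * w' s := by
  have hparts := integral_smul_add_integral_smul_eq_sub hst (h.intervalIntegrable s t)
    (h'.intervalIntegrable_mul hg s t) (fun x _ => h.sub_eq s x)
    fun x hx => h'.deriv_sub_eq x hx t (right_mem_Icc.2 hst)
  simpa only [smul_eq_mul, mul_left_comm] using hparts

theorem wronskian_eq [IsLocallyFiniteMeasure m] (hg : LocallyIntegrable g m) (hS : S.OrdConnected)
    (h : IsQuasiSolutionOn m g S u w) (h' : IsQuasiSolutionOn m g S u' w') (hs : s ∈ S)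
    (ht : t ∈ S) : u s * w' s - u' s * w s = u t * w' t - u' t * w t := by
  wlog hst : s ≤ t generalizing s t
  · exact (this ht hs (le_of_not_ge hst)).symm
  have huw' := h.integral_add_integral_eq_sub hg (h'.mono (hS.out hs ht)) hst
  have hu'w := h'.integral_add_integral_eq_sub hg (h.mono (hS.out hs ht)) hst
  simp only [mul_comm (u' _) (u _), mul_comm (w' _) (w _)] at hu'w
  linear_combination huw' - hu'w

theorem norm_deriv_le (hg : LocallyIntegrable g m)
    (h : IsQuasiSolutionOn m g (uIcc s t) u w) (hus : u s = 0) (hws : w s = 0) {x : ℝ}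
    (hx : x ∈ uIcc s t) :
    ‖w x‖ ≤ (∫ y in uIoc s t, ‖g y‖ ∂m) * |∫ y in s..x, ‖w y‖| := by
  have hw := h.intervalIntegrable
  have hsub : uIoc s x ⊆ uIoc s t := uIoc_subset_uIoc_of_uIcc_subset_uIcc
    (uIcc_subset_uIcc left_mem_uIcc hx)
  have hu_le : ∀ y ∈ uIoc s x, ‖u y‖ ≤ |∫ z in s..x, ‖w z‖| := fun y hy => by
    rw [← sub_zero (u y), ← hus, h.sub_eq]
    refine intervalIntegral.norm_integral_le_abs_integral_norm.trans ?_
    refine intervalIntegral.abs_integral_mono_interval ?_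
      (Eventually.of_forall fun _ => norm_nonneg _) (hw s x).norm
    exact uIoc_subset_uIoc_of_uIcc_subset_uIcc
      (uIcc_subset_uIcc left_mem_uIcc (uIoc_subset_uIcc hy))
  have hg_int : IntegrableOn (fun y => ‖g y‖) (uIoc s t) m :=
    (intervalIntegrable_iff.1 (intervalIntegrable_of_locallyIntegrable hg s t)).norm
  calc ‖w x‖ = ‖∫ y in s..x, g y * u y ∂m‖ := by
        rw [← h.deriv_sub_eq s left_mem_uIcc x hx, hws, sub_zero]
    _ ≤ ∫ y in uIoc s x, ‖g y * u y‖ ∂m := intervalIntegral.norm_integral_le_integral_norm_uIoc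
    _ ≤ ∫ y in uIoc s x, ‖g y‖ * |∫ z in s..x, ‖w z‖| ∂m := by
        refine setIntegral_mono_on (intervalIntegrable_iff.1 (h.intervalIntegrable_mul hg s x)).norm
          ((hg_int.mono_set hsub).mul_const _) measurableSet_uIoc fun y hy => ?_
        rw [norm_mul]
        exact mul_le_mul_of_nonneg_left (hu_le y hy) (norm_nonneg _)
    _ = (∫ y in uIoc s x, ‖g y‖ ∂m) * |∫ z in s..x, ‖w z‖| := integral_mul_const _ _
    _ ≤ (∫ y in uIoc s t, ‖g y‖ ∂m) * |∫ z in s..x, ‖w z‖| := by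
        gcongr
        exact Eventually.of_forall fun _ => norm_nonneg _

theorem eq_zero (hg : LocallyIntegrable g m) (h : IsQuasiSolutionOn m g (uIcc s t) u w)
    (hus : u s = 0) (hws : w s = 0) : u t = 0 := by
  have hw : ∀ x ∈ uIcc s t, w x = 0 :=
    eq_zero_of_norm_le_mul_abs_integral_norm h.intervalIntegrable
      fun x hx => h.norm_deriv_le hg hus hws hx
  have hut := h.sub_eq s t
  rwa [hus, sub_zero, intervalIntegral.integral_congr hw, intervalIntegral.integral_zero] at hut

theorem eq_zero_of_eqOn_zero (hg : LocallyIntegrable g m) (hS : S.OrdConnected)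
    (h : IsQuasiSolutionOn m g S u w) {a b : ℝ} (hab : a < b) (hsub : Icc a b ⊆ S)
    (hzero : ∀ x ∈ Icc a b, u x = 0) (ht : t ∈ S) : u t = 0 := by
  have ha : a ∈ Icc a b := left_mem_Icc.2 hab.le
  have hw_const : ∀ x ∈ uIcc a b, w x = w a := by
    intro x hx
    rw [uIcc_of_le hab.le] at hx
    rw [← sub_eq_zero, h.deriv_sub_eq a (hsub ha) x (hsub hx),
      intervalIntegral.integral_congr (g := fun _ => 0), intervalIntegral.integral_zero]
    intro y hy
    rw [uIcc_of_le hx.1] at hy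
    simp only [hzero y ⟨hy.1, hy.2.trans hx.2⟩, mul_zero]
  have hwa : w a = 0 := by
    have hincrement := h.sub_eq a b
    rw [hzero a ha, hzero b (right_mem_Icc.2 hab.le), intervalIntegral.integral_congr hw_const,
      intervalIntegral.integral_const, sub_self] at hincrement
    exact (smul_eq_zero.1 hincrement.symm).resolve_left (sub_pos.2 hab).ne'
  exact (h.mono (hS.uIcc_subset (hsub ha) ht)).eq_zero hg (hzero a ha) hwa

end IsQuasiSolutionOn

end QuasiSolution

section Decay

variable {E : Type*} [NormedAddCommGroup E]

theorem tendsto_intervalIntegral_comp_add_cocompact [NormedSpace ℝ E] {f : ℝ → E}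
    (hf : Integrable f) (a b : ℝ) :
    Tendsto (fun q => ∫ x in a..b, f (x + q)) (cocompact ℝ) (𝓝 0) := by
  have htranslate (q : ℝ) : ∫ x in a..b, f (x + q)
      = (∫ x in (0 : ℝ)..(b + q), f x) - ∫ x in (0 : ℝ)..(a + q), f x := by
    rw [intervalIntegral.integral_comp_add_right, intervalIntegral.integral_interval_sub_left]
      <;> exact hf.intervalIntegrable
  simp_rw [htranslate]
  rw [cocompact_eq_atBot_atTop, tendsto_sup]
  constructor
  · have hlim (c : ℝ) : Tendsto (fun q => ∫ x in (0 : ℝ)..(c + q), f x) atBot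
        (𝓝 (-∫ x in Iic 0, f x)) := by
      simp_rw [intervalIntegral.integral_symm _ (0 : ℝ)]
      exact (intervalIntegral_tendsto_integral_Iic 0 hf.integrableOn
        (tendsto_atBot_add_const_left _ c tendsto_id)).neg
    simpa only [sub_self] using (hlim b).sub (hlim a)
  · have hlim (c : ℝ) : Tendsto (fun q => ∫ x in (0 : ℝ)..(c + q), f x) atTop
        (𝓝 (∫ x in Ioi 0, f x)) :=
      intervalIntegral_tendsto_integral_Ioi 0 hf.integrableOn
        (tendsto_atTop_add_const_left _ c tendsto_id)
    simpa only [sub_self] using (hlim b).sub (hlim a)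

theorem eqOn_zero_of_frequently_norm_le {ι : Type*} {l : Filter ι} {u : ℝ → E}
    (hu : Continuous u) (hu_sq : Integrable fun x => ‖u x‖ ^ 2) {a b : ℝ} (hab : a < b)
    {q r : ι → ℝ} (hq : Tendsto q l (cocompact ℝ)) (hr : Tendsto r l (cocompact ℝ))
    (h : ∃ᶠ n in l, ∀ x ∈ Icc a b, ‖u x‖ ≤ ‖u (x + q n)‖ + ‖u (x + r n)‖) :
    ∀ x ∈ Icc a b, u x = 0 := by
  have hcont (y : ℝ) : Continuous fun x => ‖u (x + y)‖ ^ 2 :=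
    (hu.comp (continuous_add_const y)).norm.pow 2
  have hlim : Tendsto (fun n => 2 * (∫ x in a..b, ‖u (x + q n)‖ ^ 2)
      + 2 * ∫ x in a..b, ‖u (x + r n)‖ ^ 2) l (𝓝 0) := by
    have htranslate := tendsto_intervalIntegral_comp_add_cocompact hu_sq a b
    simpa only [mul_zero, add_zero, Function.comp_def] using
      ((htranslate.comp hq).const_mul 2).add ((htranslate.comp hr).const_mul 2)
  have hle : ∃ᶠ n in l, ∫ x in a..b, ‖u x‖ ^ 2
      ≤ 2 * (∫ x in a..b, ‖u (x + q n)‖ ^ 2) + 2 * ∫ x in a..b, ‖u (x + r n)‖ ^ 2 := by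
    refine h.mono fun n hn => ?_
    have hcq := ((hcont (q n)).intervalIntegrable (μ := volume) a b).const_mul 2
    have hcr := ((hcont (r n)).intervalIntegrable (μ := volume) a b).const_mul 2
    rw [← intervalIntegral.integral_const_mul, ← intervalIntegral.integral_const_mul,
      ← intervalIntegral.integral_add hcq hcr]
    refine intervalIntegral.integral_mono_on hab.le ((hu.norm.pow 2).intervalIntegrable _ _)
      (hcq.add hcr) fun x hx => ?_
    calc ‖u x‖ ^ 2 ≤ (‖u (x + q n)‖ + ‖u (x + r n)‖) ^ 2 := by
          gcongr
          exact hn x hx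
      _ ≤ 2 * (‖u (x + q n)‖ ^ 2 + ‖u (x + r n)‖ ^ 2) := add_sq_le
      _ = 2 * ‖u (x + q n)‖ ^ 2 + 2 * ‖u (x + r n)‖ ^ 2 := mul_add _ _ _
  have hnonpos : ∫ x in a..b, ‖u x‖ ^ 2 ≤ 0 := ge_of_tendsto_of_frequently hlim hle
  by_contra! hne
  obtain ⟨x, hx, hux⟩ := hne
  exact hnonpos.not_gt <| intervalIntegral.integral_pos hab (hu.norm.pow 2).continuousOn
    (fun _ _ => sq_nonneg _) ⟨x, hx, pow_pos (norm_pos_iff.2 hux) 2⟩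

end Decay

section Gordon

variable {𝕜 : Type*} [RCLike 𝕜] {m : Measure ℝ} {g u w u' w' : ℝ → 𝕜}
  {S : Set ℝ} {s p L : ℝ}

namespace IsQuasiSolutionOn

theorem eqOn_zero_or_exists_eq_const_mul (hg : LocallyIntegrable g m) (hS : S.OrdConnected)
    (h : IsQuasiSolutionOn m g S u w) (h' : IsQuasiSolutionOn m g S u' w') (hs : s ∈ S)
    (hwronskian : u s * w' s - u' s * w s = 0) :
    (∀ x ∈ S, u x = 0) ∨ ∃ l : 𝕜, ∀ x ∈ S, u' x = l * u x := by
  by_cases hzero : u s = 0 ∧ w s = 0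
  · exact .inl fun x hx => (h.mono (hS.uIcc_subset hs hx)).eq_zero hg hzero.1 hzero.2
  obtain ⟨l, hul, hwl⟩ : ∃ l, u' s - l * u s = 0 ∧ w' s - l * w s = 0 := by
    by_cases hus : u s = 0
    · have hws : w s ≠ 0 := fun hws => hzero ⟨hus, hws⟩
      refine ⟨w' s / w s, ?_, by field_simp; ring⟩
      have hu's : u' s * w s = 0 := by linear_combination w' s * hus - hwronskian
      rw [hus, (mul_eq_zero.1 hu's).resolve_right hws, mul_zero, sub_zero]
    · refine ⟨u' s / u s, by field_simp; ring, ?_⟩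
      field_simp
      linear_combination hwronskian
  exact .inr ⟨l, fun x hx => sub_eq_zero.1 <|
    ((h'.sub_const_mul hg h l).mono (hS.uIcc_subset hs hx)).eq_zero hg hul hwl⟩

variable [IsLocallyFiniteMeasure m]

theorem exists_add_eq_const_mul (hg : LocallyIntegrable g m) (hp : 2 * L ≤ p)
    (hper : HasPeriodOn m g p (Icc (-p + L) (p - L))) (h : IsQuasiSolutionOn m g univ u w)
    (hwronskian : u L * w (L + p) - u (L + p) * w L ≠ 0) (hL : 0 ≤ L) :
    ∃ β : 𝕜, ∀ x ∈ Icc (-p + L) (-L), u (x + p + p) + u x = β * u (x + p) := by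
  have h₀ := h.mono (subset_univ (Icc (-p + L) (p - L)))
  have h₁ := h.comp_add_right hper (mapsTo_univ _ _)
  have h₂ : IsQuasiSolutionOn m g (Icc (-p + L) (-L)) (fun x => u (x + p + p))
      (fun x => w (x + p + p)) :=
    h₁.comp_add_right (hper.mono (Icc_subset_Icc_right (by linarith)))
      fun x hx => ⟨by linarith [hx.1], by linarith [hx.2]⟩
  have h₀' := h.mono (subset_univ (Icc (-p + L) (-L)))
  set c := u L * w (L + p) - u (L + p) * w L
  set d := u (-L) * w (-L + p + p) - u (-L + p + p) * w (-L)
  refine ⟨d / c, fun x hx => ?_⟩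
  have hW₀₁ : c = u x * w (x + p) - u (x + p) * w x :=
    h₀.wronskian_eq hg ordConnected_Icc h₁ ⟨by linarith, by linarith⟩ ⟨hx.1, by linarith [hx.2]⟩
  have hW₁₂ : c = u (x + p) * w (x + p + p) - u (x + p + p) * w (x + p) :=
    h₀.wronskian_eq hg ordConnected_Icc h₁ ⟨by linarith, by linarith⟩
      ⟨by linarith [hx.1], by linarith [hx.2]⟩
  have hW₀₂ : d = u x * w (x + p + p) - u (x + p + p) * w x :=
    h₀'.wronskian_eq hg ordConnected_Icc h₂ ⟨by linarith, le_rfl⟩ hx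
  rw [div_mul_eq_mul_div, eq_div_iff hwronskian]
  -- The Plücker relation between the Wronskians of three solutions.
  linear_combination u (x + p + p) * hW₀₁ - u (x + p) * hW₀₂ + u x * hW₁₂

theorem norm_le_or_norm_le (hg : LocallyIntegrable g m) (hL : 0 ≤ L) (hp : 2 * L + 1 ≤ p)
    (hper : HasPeriodOn m g p (Icc (-p + L) (p - L))) (h : IsQuasiSolutionOn m g univ u w) :
    (∀ x ∈ Icc (-L - 1) (-L), ‖u x‖ ≤ ‖u (x + p)‖ + ‖u (x + p + p)‖) ∨
      ∀ x ∈ Icc L (L + 1), ‖u x‖ ≤ ‖u (x - p)‖ + ‖u (x + p)‖ := by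
  by_cases hwronskian : u L * w (L + p) - u (L + p) * w L = 0
  · right
    intro x hx
    rcases (h.mono (subset_univ _)).eqOn_zero_or_exists_eq_const_mul hg ordConnected_Icc
      (h.comp_add_right hper (mapsTo_univ _ _)) ⟨by linarith, by linarith⟩ hwronskian
      with hu | ⟨l, hu⟩
    · rw [hu x ⟨by linarith [hx.1], by linarith [hx.2]⟩, norm_zero]
      positivity
    · have hforward := hu x ⟨by linarith [hx.1], by linarith [hx.2]⟩
      have hbackward := hu (x - p) ⟨by linarith [hx.1], by linarith [hx.2]⟩
      rw [sub_add_cancel] at hbackward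
      rcases le_total 1 ‖l‖ with hl | hl
      · rw [hforward, norm_mul]
        exact le_add_of_nonneg_of_le (norm_nonneg _) (le_mul_of_one_le_left (norm_nonneg _) hl)
      · rw [hbackward, norm_mul]
        exact le_add_of_le_of_nonneg (mul_le_of_le_one_left (norm_nonneg _) hl) (norm_nonneg _)
  · obtain ⟨β, hβ⟩ := exists_add_eq_const_mul hg (by linarith) hper h hwronskian hL
    rcases le_total ‖β‖ 1 with hβ_le | hβ_ge
    · left
      intro x hx
      calc ‖u x‖ = ‖β * u (x + p) - u (x + p + p)‖ := by
            rw [← hβ x ⟨by linarith [hx.1], hx.2⟩, add_sub_cancel_left]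
        _ ≤ ‖β‖ * ‖u (x + p)‖ + ‖u (x + p + p)‖ := (norm_sub_le _ _).trans_eq (by rw [norm_mul])
        _ ≤ ‖u (x + p)‖ + ‖u (x + p + p)‖ := by
            gcongr
            exact mul_le_of_le_one_left (norm_nonneg _) hβ_le
    · right
      intro x hx
      have hrecurrence := hβ (x - p) ⟨by linarith [hx.1], by linarith [hx.2]⟩
      rw [sub_add_cancel] at hrecurrence
      calc ‖u x‖ ≤ ‖β‖ * ‖u x‖ := le_mul_of_one_le_left (norm_nonneg _) hβ_ge
        _ = ‖u (x - p) + u (x + p)‖ := by rw [← norm_mul, ← hrecurrence, add_comm]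
        _ ≤ ‖u (x - p)‖ + ‖u (x + p)‖ := norm_add_le _ _

theorem eq_zero_of_frequently_hasPeriodOn {ι : Type*} {l : Filter ι} {p : ι → ℝ}
    (hg : LocallyIntegrable g m) (hL : 0 ≤ L) (hp : Tendsto p l atTop)
    (hper : ∃ᶠ n in l, HasPeriodOn m g (p n) (Icc (-p n + L) (p n - L)))
    (h : IsQuasiSolutionOn m g univ u w) (hu_sq : Integrable fun x => ‖u x‖ ^ 2) (x : ℝ) :
    u x = 0 := by
  have hp' : Tendsto p l (cocompact ℝ) := hp.mono_right atTop_le_cocompact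
  have hneg : Tendsto (fun n => -p n) l (cocompact ℝ) :=
    (tendsto_neg_atTop_atBot.comp hp).mono_right atBot_le_cocompact
  have hdouble : Tendsto (fun n => p n + p n) l (cocompact ℝ) :=
    (hp.atTop_add_atTop hp).mono_right atTop_le_cocompact
  have hdichotomy := (hper.and_eventually (hp.eventually_ge_atTop (2 * L + 1))).mono fun n hn =>
    norm_le_or_norm_le hg hL hn.2 hn.1 h
  obtain ⟨c, hc⟩ : ∃ c, ∀ y ∈ Icc c (c + 1), u y = 0 := by
    rcases frequently_or_distrib.1 hdichotomy with hleft | hright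
    · refine ⟨-L - 1, ?_⟩
      rw [sub_add_cancel]
      refine eqOn_zero_of_frequently_norm_le h.continuous hu_sq (sub_one_lt _) hp' hdouble ?_
      simpa only [add_assoc] using hleft
    · refine ⟨L, eqOn_zero_of_frequently_norm_le h.continuous hu_sq (lt_add_one _) hneg hp' ?_⟩
      simpa only [sub_eq_add_neg] using hright
  exact h.eq_zero_of_eqOn_zero hg ordConnected_univ (lt_add_one c) (subset_univ _) hc (mem_univ x)

end IsQuasiSolutionOn

end Gordon

section Distributions

open scoped ContDiff

variable {E : Type*} [NormedAddCommGroup E] [NormedSpace ℝ E]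

/-- The real test functions on the line: smooth and compactly supported. Distributional identities
between vector-valued functions are tested against them by scalar multiplication. -/
structure IsTestFunction (φ : ℝ → ℝ) : Prop where
  contDiff : ContDiff ℝ ∞ φ
  hasCompactSupport : HasCompactSupport φ

namespace IsTestFunction

variable {φ ψ : ℝ → ℝ}

theorem differentiable (hφ : IsTestFunction φ) : Differentiable ℝ φ :=
  (contDiff_infty_iff_deriv.1 hφ.contDiff).1

protected theorem deriv (hφ : IsTestFunction φ) : IsTestFunction (deriv φ) :=
  ⟨(contDiff_infty_iff_deriv.1 hφ.contDiff).2, hφ.hasCompactSupport.deriv⟩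

theorem sub_const_mul (hφ : IsTestFunction φ) (hψ : IsTestFunction ψ) (c : ℝ) :
    IsTestFunction fun x => φ x - c * ψ x :=
  ⟨hφ.contDiff.sub (contDiff_const.mul hψ.contDiff),
    hφ.hasCompactSupport.sub hψ.hasCompactSupport.mul_left⟩

theorem integrable_smul (hφ : IsTestFunction φ) {m : Measure ℝ} {f : ℝ → E}
    (hf : LocallyIntegrable f m) : Integrable (fun x => φ x • f x) m :=
  hf.integrable_smul_left_of_hasCompactSupport hφ.contDiff.continuous hφ.hasCompactSupport

theorem integrable (hφ : IsTestFunction φ) : Integrable φ :=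
  hφ.contDiff.continuous.integrable_of_hasCompactSupport hφ.hasCompactSupport

theorem exists_support_subset_Ioo (hφ : IsTestFunction φ) :
    ∃ a b, a < b ∧ tsupport φ ⊆ Ioo a b := by
  obtain ⟨R, hR⟩ := hφ.hasCompactSupport.isCompact.isBounded.subset_ball_lt 0 0
  rw [Real.ball_eq_Ioo, zero_sub, zero_add] at hR
  exact ⟨-R, R, by linarith [hR.1], hR.2⟩

theorem exists_integral_eq_one : ∃ η, IsTestFunction η ∧ ∫ x, η x = 1 := by
  let bump : ContDiffBump (0 : ℝ) := ⟨1, 2, one_pos, one_lt_two⟩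
  exact ⟨bump.normed volume, ⟨bump.contDiff_normed, bump.hasCompactSupport_normed⟩,
    bump.integral_normed⟩

theorem exists_deriv_eq (hψ : IsTestFunction ψ) (hψ_integral : ∫ x, ψ x = 0) :
    ∃ φ, IsTestFunction φ ∧ deriv φ = ψ := by
  obtain ⟨a, b, -, hsupp⟩ := hψ.exists_support_subset_Ioo
  have hcont := hψ.contDiff.continuous
  have hderiv (x : ℝ) : HasDerivAt (fun x => ∫ y in a..x, ψ y) (ψ x) x :=
    intervalIntegral.integral_hasDerivAt_right (hcont.intervalIntegrable _ _)
      (hcont.stronglyMeasurableAtFilter _ _) hcont.continuousAt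
  have hderiv_eq : deriv (fun x => ∫ y in a..x, ψ y) = ψ := funext fun x => (hderiv x).deriv
  refine ⟨fun x => ∫ y in a..x, ψ y, ⟨?_, ?_⟩, hderiv_eq⟩
  · rw [contDiff_infty_iff_deriv, hderiv_eq]
    exact ⟨fun x => (hderiv x).differentiableAt, hψ.contDiff⟩
  · refine HasCompactSupport.intro (K := Icc a b) isCompact_Icc fun x hx => ?_
    rw [mem_Icc, not_and_or, not_le, not_le] at hx
    rcases hx with hxa | hbx
    · refine (intervalIntegral.integral_congr fun y hy => ?_).trans intervalIntegral.integral_zero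
      rw [uIcc_of_ge hxa.le] at hy
      exact image_eq_zero_of_notMem_tsupport fun hy' => (hsupp hy').1.not_ge hy.2
    · rw [intervalIntegral.integral_eq_integral_of_support_subset, hψ_integral]
      exact (subset_tsupport ψ).trans <| hsupp.trans <|
        (Ioo_subset_Ioo_right hbx.le).trans Ioo_subset_Ioc_self

theorem exists_eq_deriv_add_mul {η : ℝ → ℝ} (hη : IsTestFunction η) (hη_integral : ∫ x, η x = 1)
    (hψ : IsTestFunction ψ) :
    ∃ φ, IsTestFunction φ ∧ ψ = fun x => deriv φ x + (∫ y, ψ y) * η x := by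
  obtain ⟨φ, hφ, hφψ⟩ := (hψ.sub_const_mul hη (∫ y, ψ y)).exists_deriv_eq (by
    rw [integral_sub hψ.integrable (hη.integrable.const_mul _), integral_const_mul, hη_integral,
      mul_one, sub_self])
  exact ⟨φ, hφ, funext fun x => by rw [hφψ, sub_add_cancel]⟩

theorem exists_ae_eq_const [CompleteSpace E] {f : ℝ → E} (hf : LocallyIntegrable f)
    (h : ∀ φ, IsTestFunction φ → ∫ x, deriv φ x • f x = 0) : ∃ c, ∀ᵐ x, f x = c := by
  obtain ⟨η, hη, hη_integral⟩ := exists_integral_eq_one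
  refine ⟨∫ x, η x • f x, ae_eq_of_integral_contDiff_smul_eq hf (locallyIntegrable_const _)
    fun ψ hψ_contDiff hψ_supp => ?_⟩
  obtain ⟨φ, hφ, hψ_eq⟩ := exists_eq_deriv_add_mul hη hη_integral ⟨hψ_contDiff, hψ_supp⟩
  have hsmul (x : ℝ) : ψ x • f x = deriv φ x • f x + (∫ y, ψ y) • η x • f x := by
    rw [smul_smul, ← add_smul, ← congrFun hψ_eq x]
  simp_rw [hsmul]
  rw [integral_add (hφ.deriv.integrable_smul hf) ((hη.integrable_smul hf).fun_smul _), h φ hφ,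
    integral_smul, zero_add, integral_smul_const]

end IsTestFunction

section Primitive

variable {m : Measure ℝ} {h : ℝ → E}

theorem primitive_sub_primitive (hh : LocallyIntegrable h m) (s t : ℝ) :
    (∫ x in (0 : ℝ)..t, h x ∂m) - ∫ x in (0 : ℝ)..s, h x ∂m = ∫ x in s..t, h x ∂m :=
  intervalIntegral.integral_interval_sub_left (intervalIntegrable_of_locallyIntegrable hh _ _)
    (intervalIntegrable_of_locallyIntegrable hh _ _)

theorem locallyIntegrable_primitive [IsLocallyFiniteMeasure m] (hh : LocallyIntegrable h m) :
    LocallyIntegrable fun t => ∫ x in (0 : ℝ)..t, h x ∂m := by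
  intro a
  refine ⟨Ioc (a - 1) (a + 1), Ioc_mem_nhds (sub_one_lt a) (lt_add_one a), ?_⟩
  have hle : a - 1 ≤ a + 1 := by linarith
  rw [← intervalIntegrable_iff_integrableOn_Ioc_of_le hle]
  have htail := intervalIntegrable_smul_integral_right (f := fun _ => (1 : ℝ)) hle
    intervalIntegrable_const (intervalIntegrable_of_locallyIntegrable hh _ _)
  refine (intervalIntegrable_const (c := ∫ x in (0 : ℝ)..(a + 1), h x ∂m)).sub htail |>.congr
    fun y _ => ?_
  simp only [one_smul, ← primitive_sub_primitive hh y, sub_sub_cancel]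

theorem IsTestFunction.integral_smul_eq_neg_integral_deriv_smul_primitive
    [IsLocallyFiniteMeasure m] [CompleteSpace E] {φ : ℝ → ℝ} (hφ : IsTestFunction φ)
    (hh : LocallyIntegrable h m) :
    ∫ x, φ x • h x ∂m = -∫ t, deriv φ t • ∫ x in (0 : ℝ)..t, h x ∂m := by
  obtain ⟨a, b, hab, hsupp⟩ := hφ.exists_support_subset_Ioo
  have hφa : φ a = 0 := image_eq_zero_of_notMem_tsupport fun ha => (hsupp ha).1.false
  have hφb : φ b = 0 := image_eq_zero_of_notMem_tsupport fun hb => (hsupp hb).2.false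
  have hparts := integral_smul_add_integral_smul_eq_sub hab.le
    (hφ.deriv.contDiff.continuous.intervalIntegrable a b)
    (intervalIntegrable_of_locallyIntegrable hh a b) (U := φ)
    (V := fun t => ∫ x in (0 : ℝ)..t, h x ∂m)
    (fun x _ => (intervalIntegral.integral_deriv_eq_sub (fun y _ => hφ.differentiable y)
      (hφ.deriv.contDiff.continuous.intervalIntegrable a x)).symm)
    (fun x _ => primitive_sub_primitive hh x b)
  rw [hφa, hφb, zero_smul, zero_smul, sub_zero,
    intervalIntegral.integral_eq_integral_of_support_subset,
    intervalIntegral.integral_eq_integral_of_support_subset] at hparts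
  · exact eq_neg_of_add_eq_zero_left hparts
  · exact (Function.support_smul_subset_left _ _).trans <| support_deriv_subset.trans <|
      hsupp.trans Ioo_subset_Ioc_self
  · exact (Function.support_smul_subset_left _ _).trans <| (subset_tsupport φ).trans <|
      hsupp.trans Ioo_subset_Ioc_self

end Primitive

namespace IsTestFunction

variable [CompleteSpace E]

theorem exists_ae_eq_add_smul {f : ℝ → E} (hf : LocallyIntegrable f)
    (h : ∀ φ, IsTestFunction φ → ∫ x, deriv (deriv φ) x • f x = 0) :
    ∃ c₀ c₁ : E, ∀ᵐ x, f x = c₀ + x • c₁ := by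
  obtain ⟨η, hη, hη_integral⟩ := exists_integral_eq_one
  set c := ∫ x, deriv η x • f x
  have hderiv (ψ : ℝ → ℝ) (hψ : IsTestFunction ψ) : ∫ x, deriv ψ x • f x = (∫ x, ψ x) • c := by
    obtain ⟨φ, hφ, hψ_eq⟩ := exists_eq_deriv_add_mul hη hη_integral hψ
    have hsmul (x : ℝ) :
        deriv ψ x • f x = deriv (deriv φ) x • f x + (∫ y, ψ y) • deriv η x • f x := by
      rw [smul_smul, ← add_smul, congrArg deriv hψ_eq, deriv_fun_add (hφ.deriv.differentiable x)
        ((hη.differentiable x).const_mul _), deriv_const_mul_field]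
    simp_rw [hsmul]
    rw [integral_add (hφ.deriv.deriv.integrable_smul hf)
      ((hη.deriv.integrable_smul hf).fun_smul _), h φ hφ, integral_smul, zero_add]
  have hlinear : LocallyIntegrable fun x : ℝ => x • c :=
    (continuous_id.smul continuous_const).locallyIntegrable
  obtain ⟨c₀, hc₀⟩ := exists_ae_eq_const (hf.add hlinear) fun ψ hψ => by
    have hparts := hψ.integral_smul_eq_neg_integral_deriv_smul_primitive
      (locallyIntegrable_const (μ := volume) c)
    simp only [intervalIntegral.integral_const, sub_zero, integral_smul_const] at hparts
    simp only [Pi.add_apply, smul_add]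
    rw [integral_add (hψ.deriv.integrable_smul hf) (hψ.deriv.integrable_smul hlinear),
      hderiv ψ hψ, hparts, neg_add_cancel]
  refine ⟨c₀, -c, hc₀.mono fun x hx => ?_⟩
  rw [smul_neg, ← sub_eq_add_neg, eq_sub_iff_add_eq]
  exact hx

end IsTestFunction

theorem exists_eq_integral_of_forall_integral_deriv_deriv_smul_eq [CompleteSpace E] {m : Measure ℝ}
    [IsLocallyFiniteMeasure m] {h u : ℝ → E} (hh : LocallyIntegrable h m) (hu : Continuous u)
    (hweak : ∀ φ, IsTestFunction φ → ∫ x, deriv (deriv φ) x • u x = ∫ x, φ x • h x ∂m) :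
    ∃ w : ℝ → E, LocallyIntegrable w ∧ (∀ s t, u t - u s = ∫ x in s..t, w x) ∧
      ∀ s t, w t - w s = ∫ x in s..t, h x ∂m := by
  set H : ℝ → E := fun t => ∫ x in (0 : ℝ)..t, h x ∂m with hH_def
  have hH : LocallyIntegrable H := locallyIntegrable_primitive hh
  have hprimitive : Continuous fun t => ∫ x in (0 : ℝ)..t, H x :=
    intervalIntegral.continuous_primitive (intervalIntegrable_of_locallyIntegrable hH) 0
  have hcont := hu.sub hprimitive
  obtain ⟨c₀, c₁, hae⟩ := IsTestFunction.exists_ae_eq_add_smul hcont.locallyIntegrable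
    fun φ hφ => by
      have hφ'' := hφ.deriv.deriv
      simp only [Pi.sub_apply, smul_sub]
      rw [integral_sub (hφ''.integrable_smul hu.locallyIntegrable)
        (hφ''.integrable_smul hprimitive.locallyIntegrable), hweak φ hφ,
        hφ.integral_smul_eq_neg_integral_deriv_smul_primitive hh,
        hφ.deriv.integral_smul_eq_neg_integral_deriv_smul_primitive hH, neg_neg, sub_self]
  have haffine (x : ℝ) : u x = (∫ y in (0 : ℝ)..x, H y) + (c₀ + x • c₁) := by
    have := congrFun ((hcont.ae_eq_iff_eq volume (by fun_prop)).1 hae) x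
    rwa [Pi.sub_apply, sub_eq_iff_eq_add'] at this
  refine ⟨fun x => H x + c₁, hH.add (locallyIntegrable_const c₁), fun s t => ?_, fun s t => ?_⟩
  · rw [intervalIntegral.integral_add (intervalIntegrable_of_locallyIntegrable hH s t)
      intervalIntegrable_const, intervalIntegral.integral_const, ← primitive_sub_primitive hH s t,
      haffine t, haffine s, sub_smul]
    abel
  · rw [add_sub_add_right_eq_sub, hH_def, primitive_sub_primitive hh]

end Distributions

section Measures

variable {X : Type*} [MeasurableSpace X]

theorem add_eq_add_of_measureReal_sub_eq {a b c d : Measure X} [IsFiniteMeasure a]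
    [IsFiniteMeasure b] [IsFiniteMeasure c] [IsFiniteMeasure d]
    (h : ∀ B, MeasurableSet B → a.real B - b.real B = c.real B - d.real B) : a + d = c + b := by
  ext B hB
  rw [← ENNReal.toReal_eq_toReal_iff' (measure_ne_top _ _) (measure_ne_top _ _)]
  change (a + d).real B = (c + b).real B
  rw [measureReal_add_apply, measureReal_add_apply]
  linarith [h B hB]

variable [TopologicalSpace X]

instance isLocallyFiniteMeasure_add (a b : Measure X) [IsLocallyFiniteMeasure a]
    [IsLocallyFiniteMeasure b] : IsLocallyFiniteMeasure (a + b) where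
  finiteAtNhds x := by
    obtain ⟨s, hs, has⟩ := a.finiteAt_nhds x
    obtain ⟨t, ht, hbt⟩ := b.finiteAt_nhds x
    exact ⟨s ∩ t, inter_mem hs ht, ENNReal.add_lt_top.2
      ⟨(measure_mono inter_subset_left).trans_lt has,
        (measure_mono inter_subset_right).trans_lt hbt⟩⟩

variable [T2Space X] [LocallyCompactSpace X] [SecondCountableTopology X] [BorelSpace X]
  {a b : Measure X} [IsLocallyFiniteMeasure a] [IsLocallyFiniteMeasure b] {U : Set X}

theorem restrict_isCompact_eq_of_forall_integral_eq (hU : IsOpen U)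
    (h : ∀ φ : C_c(X, ℝ), tsupport φ ⊆ U → ∫ x, φ x ∂a = ∫ x, φ x ∂b) {K : Set X}
    (hK : IsCompact K) (hKU : K ⊆ U) : a.restrict K = b.restrict K := by
  obtain ⟨χ, hχ_one, hχ_compact, hχU, hχ⟩ :=
    exists_continuousMap_one_of_isCompact_subset_isOpen hK hU hKU
  have restrict_eq (m : Measure X) :
      (m.withDensity fun x => ENNReal.ofReal (χ x)).restrict K = m.restrict K := by
    rw [restrict_withDensity hK.measurableSet]
    convert withDensity_one using 1
    refine withDensity_congr_ae (ae_restrict_of_forall_mem hK.measurableSet fun x hx => ?_)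
    simp only [hχ_one hx, Pi.one_apply, ENNReal.ofReal_one]
  have isFiniteMeasure (m : Measure X) [IsLocallyFiniteMeasure m] :
      IsFiniteMeasure (m.withDensity fun x => ENNReal.ofReal (χ x)) :=
    isFiniteMeasure_withDensity_ofReal
      (χ.continuous.integrable_of_hasCompactSupport hχ_compact).hasFiniteIntegral
  have integral_eq (m : Measure X) (f : X → ℝ) :
      ∫ x, f x ∂(m.withDensity fun x => ENNReal.ofReal (χ x)) = ∫ x, χ x * f x ∂m := by
    rw [integral_withDensity_eq_integral_toReal_smul χ.measurable.ennreal_ofReal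
      (Eventually.of_forall fun _ => ENNReal.ofReal_lt_top)]
    simp only [ENNReal.toReal_ofReal (hχ _).1, smul_eq_mul]
  have := isFiniteMeasure a
  have := isFiniteMeasure b
  rw [← restrict_eq a, ← restrict_eq b]
  congr 1
  refine ext_of_forall_integral_eq_of_IsFiniteMeasure fun f => ?_
  rw [integral_eq, integral_eq]
  exact h ⟨⟨fun x => χ x * f x, χ.continuous.mul f.continuous⟩, HasCompactSupport.mul_right
    hχ_compact⟩ ((tsupport_mul_subset_left (f := χ) (g := f)).trans hχU)

theorem restrict_isOpen_eq_of_forall_integral_eq (hU : IsOpen U)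
    (h : ∀ φ : C_c(X, ℝ), tsupport φ ⊆ U → ∫ x, φ x ∂a = ∫ x, φ x ∂b) :
    a.restrict U = b.restrict U := by
  have := hU.locallyCompactSpace
  obtain ⟨K, hK, rfl⟩ : IsSigmaCompact U := isSigmaCompact_iff_sigmaCompactSpace.2 inferInstance
  exact Measure.restrict_iUnion_congr.2 fun n =>
    restrict_isCompact_eq_of_forall_integral_eq hU h (hK n) (subset_iUnion K n)

end Measures

namespace LocalMeasure

variable {E : Type*} [NormedAddCommGroup E] [NormedSpace ℝ E] {μ ν : LocalMeasure} {S T : Set ℝ}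

instance (μ : LocalMeasure) : IsLocallyFiniteMeasure μ.posPart :=
  isLocallyFiniteMeasure_of_isFiniteMeasureOnCompacts

instance (μ : LocalMeasure) : IsLocallyFiniteMeasure μ.negPart :=
  isLocallyFiniteMeasure_of_isFiniteMeasureOnCompacts

theorem restrictIcc_eq_toFun (μ : LocalMeasure) {a b : ℝ} (B : BoundedBorel)
    (hB : B.1 ⊆ Icc a b) : μ.restrictIcc a b B.1 = μ.toFun B := by
  rw [restrictIcc_apply _ _ _ _ B.2.2]
  exact congrArg μ.toFun (Subtype.ext (inter_eq_left.2 hB))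

theorem hasSum_restrictIcc_inter_Ioc (μ : LocalMeasure) (B : BoundedBorel) :
    HasSum (fun n : ℤ => μ.restrictIcc n (n + 1) (B.1 ∩ Ioc (n : ℝ) (n + 1))) (μ.toFun B) := by
  obtain ⟨R, hR⟩ := B.2.1.subset_closedBall 0
  rw [Real.closedBall_eq_Icc] at hR
  let piece (n : ℤ) : BoundedBorel := ⟨B.1 ∩ Ioc (n : ℝ) (n + 1),
    B.2.1.subset inter_subset_left, B.2.2.inter measurableSet_Ioc⟩
  have hsum := (μ.restrictIcc (0 - R) (0 + R)).hasSum_of_disjoint_iUnion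
    (fun n => (piece n).2.2) fun i j hij =>
      (pairwise_disjoint_Ioc_intCast ℝ hij).mono inter_subset_right inter_subset_right
  rw [← inter_iUnion, iUnion_Ioc_intCast, inter_univ, restrictIcc_eq_toFun μ B hR] at hsum
  refine hsum.congr_fun fun n => ?_
  rw [μ.restrictIcc_eq_toFun (piece n) (inter_subset_left.trans hR),
    μ.restrictIcc_eq_toFun (piece n) (inter_subset_right.trans Ioc_subset_Icc_self)]

theorem hasSum_measureReal_sum_restrict_Ioc (m : ℤ → Measure ℝ) [∀ n, IsFiniteMeasure (m n)]
    (B : BoundedBorel) : HasSum (fun n : ℤ => (m n).real (B.1 ∩ Ioc (n : ℝ) (n + 1)))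
      ((Measure.sum fun n : ℤ => (m n).restrict (Ioc (n : ℝ) (n + 1))).real B.1) := by
  have := isFiniteMeasureOnCompacts_sum m
  have hfin := (B.2.1.measure_lt_top
    (μ := Measure.sum fun n : ℤ => (m n).restrict (Ioc (n : ℝ) (n + 1)))).ne
  rw [Measure.real]
  rw [Measure.sum_apply _ B.2.2] at hfin ⊢
  simp_rw [Measure.restrict_apply B.2.2] at hfin ⊢
  rw [ENNReal.tsum_toReal_eq (ENNReal.ne_top_of_tsum_ne_top hfin)]
  exact ENNReal.hasSum_toReal hfin

theorem toFun_eq_measureReal_sub (μ : LocalMeasure) (B : BoundedBorel) :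
    μ.toFun B = μ.posPart.real B.1 - μ.negPart.real B.1 := by
  refine (μ.hasSum_restrictIcc_inter_Ioc B).unique ?_
  simp_rw [SignedMeasure.apply_eq_posPart_real_sub_negPart_real _ (B.2.2.inter measurableSet_Ioc)]
  exact (hasSum_measureReal_sum_restrict_Ioc _ B).sub (hasSum_measureReal_sum_restrict_Ioc _ B)

/-- The integral `∫_S f dμ`; it is used only for bounded measurable sets `S` and functions `f` that
are continuous or vanish outside `S`. -/
noncomputable def setIntegral (μ : LocalMeasure) (S : Set ℝ) (f : ℝ → E) : E :=
  ∫ x in S, f x ∂μ.posPart - ∫ x in S, f x ∂μ.negPart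

theorem setIntegral_eq_integral {f : ℝ → E} (hf : ∀ x ∉ S, f x = 0) :
    μ.setIntegral S f = μ.integral f := by
  rw [setIntegral, setIntegral_eq_integral_of_forall_compl_eq_zero hf,
    setIntegral_eq_integral_of_forall_compl_eq_zero hf, integral]

theorem setIntegral_eq_of_toFun_eq_measureReal_sub {a b : Measure ℝ} [IsLocallyFiniteMeasure a]
    [IsLocallyFiniteMeasure b] (hS : MeasurableSet S) (hSb : Bornology.IsBounded S)
    (h : ∀ B : BoundedBorel, B.1 ⊆ S → μ.toFun B = a.real B.1 - b.real B.1) {f : ℝ → E}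
    (hf : Continuous f) :
    μ.setIntegral S f = ∫ x in S, f x ∂a - ∫ x in S, f x ∂b := by
  have finite (m : Measure ℝ) [IsLocallyFiniteMeasure m] : IsFiniteMeasure (m.restrict S) :=
    ⟨by rw [Measure.restrict_apply_univ]; exact hSb.measure_lt_top⟩
  have integrable (m : Measure ℝ) [IsLocallyFiniteMeasure m] : Integrable f (m.restrict S) :=
    (hf.locallyIntegrable.integrableOn_isCompact hSb.isCompact_closure).mono_set subset_closure
  have := finite a
  have := finite b
  have := finite μ.posPart
  have := finite μ.negPart
  have hsum : μ.posPart.restrict S + b.restrict S = a.restrict S + μ.negPart.restrict S := by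
    refine add_eq_add_of_measureReal_sub_eq fun B hB => ?_
    simp only [measureReal_restrict_apply hB]
    let B' : BoundedBorel := ⟨B ∩ S, hSb.subset inter_subset_right, hB.inter hS⟩
    exact (μ.toFun_eq_measureReal_sub B').symm.trans (h B' inter_subset_right)
  rw [setIntegral, sub_eq_sub_iff_add_eq_add, ← integral_add_measure (integrable _) (integrable _),
    ← integral_add_measure (integrable _) (integrable _), hsum]

theorem setIntegral_translate (t : ℝ) (hS : MeasurableSet S) (hSb : Bornology.IsBounded S)
    {f : ℝ → E} (hf : Continuous f) :
    (μ.translate t).setIntegral S f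
      = μ.setIntegral ((fun x => x - t) ⁻¹' S) fun x => f (x - t) := by
  have locallyFinite (m : Measure ℝ) [IsLocallyFiniteMeasure m] :
      IsLocallyFiniteMeasure (m.map (Homeomorph.subRight t)) :=
    have := Measure.IsFiniteMeasureOnCompacts.map m (Homeomorph.subRight t)
    isLocallyFiniteMeasure_of_isFiniteMeasureOnCompacts
  have := locallyFinite μ.posPart
  have := locallyFinite μ.negPart
  have hm := (Homeomorph.subRight t).measurableEmbedding
  rw [setIntegral_eq_of_toFun_eq_measureReal_sub (a := μ.posPart.map (Homeomorph.subRight t))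
    (b := μ.negPart.map (Homeomorph.subRight t)) hS hSb (fun B _ => ?_) hf,
    hm.setIntegral_map, hm.setIntegral_map]
  · rfl
  · rw [map_measureReal_apply hm.measurable B.2.2, map_measureReal_apply hm.measurable B.2.2]
    exact μ.toFun_eq_measureReal_sub (B.translate t)

theorem integral_translate (t : ℝ) (φ : C_c(ℝ, ℝ)) :
    (μ.translate t).integral φ = μ.integral fun x => φ (x - t) := by
  have hφ := φ.hasCompactSupport.isCompact
  rw [← setIntegral_eq_integral fun x => image_eq_zero_of_notMem_tsupport,
    setIntegral_translate t hφ.measurableSet hφ.isBounded (map_continuous φ)]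
  exact setIntegral_eq_integral fun x hx => image_eq_zero_of_notMem_tsupport hx

theorem translate_translate (μ : LocalMeasure) (s t : ℝ) :
    (μ.translate s).translate t = μ.translate (s + t) := by
  ext B
  refine congrArg μ.toFun (Subtype.ext ?_)
  ext x
  simp only [BoundedBorel.translate, mem_preimage, sub_sub]

theorem translate_zero (μ : LocalMeasure) : μ.translate 0 = μ := by
  ext B
  refine congrArg μ.toFun (Subtype.ext ?_)
  ext x
  simp only [BoundedBorel.translate, mem_preimage, sub_zero]

/-- The local measures `μ` and `ν` agree on the set `S`, that is `1_S μ = 1_S ν`. -/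
def AgreesOn (μ ν : LocalMeasure) (S : Set ℝ) : Prop :=
  ∀ B : BoundedBorel, B.1 ⊆ S → μ.toFun B = ν.toFun B

theorem agreesOn_Icc_of_restrictIcc_eq {a b : ℝ} (h : μ.restrictIcc a b = ν.restrictIcc a b) :
    μ.AgreesOn ν (Icc a b) := fun B hB => by
  rw [← μ.restrictIcc_eq_toFun B hB, h, ν.restrictIcc_eq_toFun B hB]

namespace AgreesOn

theorem symm (h : μ.AgreesOn ν S) : ν.AgreesOn μ S := fun B hB => (h B hB).symm

theorem mono (h : μ.AgreesOn ν S) (hTS : T ⊆ S) : μ.AgreesOn ν T := fun B hB => h B (hB.trans hTS)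

theorem union (hS : μ.AgreesOn ν S) (hT : μ.AgreesOn ν T) (hSm : MeasurableSet S) :
    μ.AgreesOn ν (S ∪ T) := by
  intro B hB
  let B₁ : BoundedBorel := ⟨B.1 ∩ S, B.2.1.subset inter_subset_left, B.2.2.inter hSm⟩
  let B₂ : BoundedBorel := ⟨B.1 \ S, B.2.1.subset sdiff_subset, B.2.2.diff hSm⟩
  have toFun_eq_add (ρ : LocalMeasure) : ρ.toFun B = ρ.toFun B₁ + ρ.toFun B₂ := by
    have measureReal_eq_add (m : Measure ℝ) [IsLocallyFiniteMeasure m] :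
        m.real B.1 = m.real B₁.1 + m.real B₂.1 :=
      (measureReal_inter_add_sdiff hSm B.2.1.measure_lt_top.ne).symm
    rw [ρ.toFun_eq_measureReal_sub B, ρ.toFun_eq_measureReal_sub B₁,
      ρ.toFun_eq_measureReal_sub B₂, measureReal_eq_add, measureReal_eq_add ρ.negPart]
    ring
  rw [toFun_eq_add μ, toFun_eq_add ν, hS B₁ inter_subset_right,
    hT B₂ fun x hx => (hB hx.1).resolve_left hx.2]

theorem translate (h : μ.AgreesOn ν S) (t : ℝ) :
    (μ.translate t).AgreesOn (ν.translate t) ((fun x => x + t) ⁻¹' S) := by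
  refine fun B hB => h (B.translate t) fun x hx => ?_
  simpa only [mem_preimage, sub_add_cancel] using hB hx

theorem setIntegral_eq (h : μ.AgreesOn ν S) (hS : MeasurableSet S) (hSb : Bornology.IsBounded S)
    {f : ℝ → E} (hf : Continuous f) : μ.setIntegral S f = ν.setIntegral S f :=
  setIntegral_eq_of_toFun_eq_measureReal_sub hS hSb
    (fun B hB => (h B hB).trans (ν.toFun_eq_measureReal_sub B)) hf

end AgreesOn

theorem agreesOn_iff_forall_integral_eq (hS : IsOpen S) :
    μ.AgreesOn ν S ↔ ∀ φ : C_c(ℝ, ℝ), tsupport φ ⊆ S → μ.integral φ = ν.integral φ := by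
  refine ⟨fun h φ hφS => ?_, fun h B hB => ?_⟩
  · have hφ := φ.hasCompactSupport.isCompact
    have := (h.mono hφS).setIntegral_eq hφ.measurableSet hφ.isBounded (map_continuous φ)
    rwa [setIntegral_eq_integral fun x => image_eq_zero_of_notMem_tsupport,
      setIntegral_eq_integral fun x => image_eq_zero_of_notMem_tsupport] at this
  · have integrable (φ : C_c(ℝ, ℝ)) (m : Measure ℝ) [IsLocallyFiniteMeasure m] :
        Integrable φ m := φ.continuous.integrable_of_hasCompactSupport φ.hasCompactSupport
    have hrestrict : (μ.posPart + ν.negPart).restrict S = (ν.posPart + μ.negPart).restrict S := by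
      refine restrict_isOpen_eq_of_forall_integral_eq hS fun φ hφ => ?_
      rw [integral_add_measure (integrable φ _) (integrable φ _),
        integral_add_measure (integrable φ _) (integrable φ _), ← sub_eq_sub_iff_add_eq_add]
      exact h φ hφ
    have hB_eq : (μ.posPart + ν.negPart).real B.1 = (ν.posPart + μ.negPart).real B.1 := by
      rw [Measure.real, ← Measure.restrict_eq_self _ hB, hrestrict, Measure.restrict_eq_self _ hB,
        Measure.real]
    have finite (m : Measure ℝ) [IsLocallyFiniteMeasure m] : m B.1 ≠ ∞ := B.2.1.measure_lt_top.ne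
    rw [measureReal_add_apply (finite _) (finite _), measureReal_add_apply (finite _) (finite _)]
      at hB_eq
    rw [μ.toFun_eq_measureReal_sub, ν.toFun_eq_measureReal_sub]
    linarith

theorem continuous_integral (φ : C_c(ℝ, ℝ)) : Continuous fun μ : LocalMeasure => μ.integral φ :=
  (continuous_apply φ).comp
    (continuous_induced_dom (f := fun (μ : LocalMeasure) (φ : C_c(ℝ, ℝ)) => μ.integral φ))

theorem continuous_translate (t : ℝ) : Continuous (translate t) := by
  refine continuous_induced_rng.2 (continuous_pi fun φ => ?_)
  let φ' : C_c(ℝ, ℝ) := ⟨⟨fun x => φ (x - t), φ.continuous.comp (continuous_sub_right t)⟩,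
    φ.hasCompactSupport.comp_homeomorph (Homeomorph.subRight t)⟩
  exact (continuous_integral φ').congr fun μ => (integral_translate t φ).symm

theorem isClosed_setOf_agreesOn_translate (t : ℝ) (hS : IsOpen S) :
    IsClosed {μ : LocalMeasure | μ.AgreesOn (μ.translate t) S} := by
  simp only [agreesOn_iff_forall_integral_eq hS, ofPred_forall]
  exact isClosed_iInter fun φ => isClosed_iInter fun _ => isClosed_eq (continuous_integral φ)
    ((continuous_integral φ).comp (continuous_translate t))

/-- The local measures `μ` with `1_[0,p] μ = 1_[0,p] α_p μ = 1_[0,p] α_{-p} μ`. -/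
def gordonSet (p : ℝ) : Set LocalMeasure :=
  {μ | μ.restrictIcc 0 p = (μ.translate p).restrictIcc 0 p ∧
    (μ.translate p).restrictIcc 0 p = (μ.translate (-p)).restrictIcc 0 p}

theorem agreesOn_translate_of_mem_gordonSet {p : ℝ} (h : μ ∈ gordonSet p) :
    μ.AgreesOn (μ.translate p) (Ioo (-p) p) := by
  have right : μ.AgreesOn (μ.translate p) (Icc 0 p) := agreesOn_Icc_of_restrictIcc_eq h.1
  have left := (agreesOn_Icc_of_restrictIcc_eq (h.1.trans h.2)).symm.translate p
  rw [translate_translate, neg_add_cancel, translate_zero] at left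
  refine (right.union left measurableSet_Icc).mono fun x hx => ?_
  rcases le_total 0 x with h0 | h0
  · exact Or.inl ⟨h0, hx.2.le⟩
  · exact Or.inr ⟨by linarith [hx.1], by linarith⟩

end LocalMeasure

namespace LocalMeasure

variable (μ : LocalMeasure) {S : Set ℝ}

/-- A locally finite measure with respect to which `μ` and the Lebesgue measure have densities; it
serves as reference measure for writing `-u'' + u μ = z u` as a quasi-differential equation. -/
noncomputable def dominating : Measure ℝ := μ.posPart + μ.negPart + volume

instance : IsLocallyFiniteMeasure μ.dominating :=
  inferInstanceAs (IsLocallyFiniteMeasure (μ.posPart + μ.negPart + volume))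

theorem posPart_absolutelyContinuous_dominating : μ.posPart ≪ μ.dominating :=
  Measure.absolutelyContinuous_of_le
    ((Measure.le_add_right le_rfl).trans (Measure.le_add_right le_rfl))

theorem negPart_absolutelyContinuous_dominating : μ.negPart ≪ μ.dominating :=
  Measure.absolutelyContinuous_of_le
    ((Measure.le_add_left le_rfl).trans (Measure.le_add_right le_rfl))

theorem volume_absolutelyContinuous_dominating : volume ≪ μ.dominating :=
  Measure.absolutelyContinuous_of_le (Measure.le_add_left le_rfl)

/-- The density of `μ - z dx` with respect to `μ.dominating`. -/
noncomputable def density (z : ℂ) (x : ℝ) : ℂ :=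
  (μ.posPart.rnDeriv μ.dominating x).toReal - (μ.negPart.rnDeriv μ.dominating x).toReal
    - z * (volume.rnDeriv μ.dominating x).toReal

theorem locallyIntegrable_density (z : ℂ) : LocallyIntegrable (μ.density z) μ.dominating := by
  have rnDeriv (m : Measure ℝ) [IsLocallyFiniteMeasure m] :
      LocallyIntegrable (fun x => ((m.rnDeriv μ.dominating x).toReal : ℂ)) μ.dominating :=
    locallyIntegrable_iff.2 fun K hK =>
      (Measure.integrableOn_toReal_rnDeriv hK.measure_lt_top.ne).ofReal
  exact ((rnDeriv _).sub (rnDeriv _)).sub ((rnDeriv _).smul z)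

theorem setIntegral_density_mul (z : ℂ) (hS : MeasurableSet S) {f : ℝ → ℂ}
    (hf : ∀ (m : Measure ℝ) [IsLocallyFiniteMeasure m], IntegrableOn f S m) :
    ∫ x in S, μ.density z x * f x ∂μ.dominating = μ.setIntegral S f - z * ∫ x in S, f x := by
  have integrable (m : Measure ℝ) [IsLocallyFiniteMeasure m] (hm : m ≪ μ.dominating) :
      IntegrableOn (fun x => ((m.rnDeriv μ.dominating x).toReal : ℂ) * f x) S μ.dominating := by
    rw [← integrable_indicator_iff hS]
    refine ((integrable_rnDeriv_smul_iff hm).2 ((hf m).integrable_indicator hS)).congr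
      (Eventually.of_forall fun x => ?_)
    by_cases hx : x ∈ S <;> simp [hx]
  have integral_eq (m : Measure ℝ) [IsLocallyFiniteMeasure m] (hm : m ≪ μ.dominating) :
      ∫ x in S, ((m.rnDeriv μ.dominating x).toReal : ℂ) * f x ∂μ.dominating
        = ∫ x in S, f x ∂m := by
    simp_rw [← Complex.real_smul]
    exact setIntegral_rnDeriv_smul hm hS
  have hpos := integrable _ μ.posPart_absolutelyContinuous_dominating
  have hneg := integrable _ μ.negPart_absolutelyContinuous_dominating
  have hvol := integrable _ μ.volume_absolutelyContinuous_dominating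
  have hsub : IntegrableOn (fun x => ((μ.posPart.rnDeriv μ.dominating x).toReal : ℂ) * f x
      - ((μ.negPart.rnDeriv μ.dominating x).toReal : ℂ) * f x) S μ.dominating := hpos.sub hneg
  simp only [density, sub_mul, mul_assoc]
  rw [integral_sub hsub (hvol.const_mul z), integral_sub hpos hneg, integral_const_mul,
    integral_eq _ μ.posPart_absolutelyContinuous_dominating,
    integral_eq _ μ.negPart_absolutelyContinuous_dominating,
    integral_eq _ μ.volume_absolutelyContinuous_dominating, setIntegral]

theorem intervalIntegral_density_mul (z : ℂ) {f : ℝ → ℂ} (hf : Continuous f) {s t : ℝ}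
    (hst : s ≤ t) : ∫ x in s..t, μ.density z x * f x ∂μ.dominating
      = μ.setIntegral (Ioc s t) f - z * ∫ x in s..t, f x := by
  simp only [intervalIntegral.integral_of_le hst]
  exact μ.setIntegral_density_mul z measurableSet_Ioc fun m _ => hf.integrableOn_Ioc

variable {μ}

theorem AgreesOn.hasPeriodOn {p : ℝ} (h : μ.AgreesOn (μ.translate p) S) (hS : S.OrdConnected)
    (z : ℂ) : HasPeriodOn μ.dominating (μ.density z) p S := by
  intro f hf s hs t ht
  wlog hst : s ≤ t generalizing s t
  · rw [intervalIntegral.integral_symm, this t ht s hs (le_of_not_ge hst),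
      ← intervalIntegral.integral_symm]
  have hf' : Continuous fun x => f (x + p) := hf.comp (continuous_add_const p)
  have hsub : Ioc s t ⊆ S := Ioc_subset_Icc_self.trans (hS.out hs ht)
  rw [μ.intervalIntegral_density_mul z hf' hst, μ.intervalIntegral_density_mul z hf (by gcongr),
    intervalIntegral.integral_comp_add_right, (h.mono hsub).setIntegral_eq measurableSet_Ioc
      (Metric.isBounded_Ioc s t) hf', setIntegral_translate p measurableSet_Ioc
      (Metric.isBounded_Ioc s t) hf', preimage_sub_const_Ioc]
  simp only [sub_add_cancel]

theorem WeakEquation.integral_deriv_deriv_smul_eq {z : ℂ} {u f : ℝ → ℂ} (hu : Continuous u)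
    (hf : f =ᵐ[volume] fun x => z * u x) (h : μ.WeakEquation u f) {φ : ℝ → ℝ}
    (hφ : IsTestFunction φ) :
    ∫ x, deriv (deriv φ) x • u x = ∫ x, φ x • (μ.density z x * u x) ∂μ.dominating := by
  have hφ' := h (fun x => φ x) (Complex.ofRealCLM.contDiff.comp hφ.contDiff)
    (hφ.hasCompactSupport.comp_left Complex.ofReal_zero)
  have deriv_ofReal {ψ : ℝ → ℝ} (hψ : Differentiable ℝ ψ) :
      deriv (fun x => (ψ x : ℂ)) = fun x => ((deriv ψ x : ℝ) : ℂ) :=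
    funext fun x => (hψ x).hasDerivAt.ofReal_comp.deriv
  have integral_f : ∫ x, f x * φ x = z * ∫ x, u x * φ x := by
    rw [← integral_const_mul]
    refine integral_congr_ae ?_
    filter_upwards [hf] with x hx
    rw [hx, mul_assoc]
  have integral_density := μ.setIntegral_density_mul z (f := fun x => u x * φ x)
    MeasurableSet.univ fun m _ => ?_
  · rw [Measure.restrict_univ, Measure.restrict_univ,
      setIntegral_eq_integral fun x hx => absurd (mem_univ x) hx] at integral_density
    rw [iteratedDeriv_succ, iteratedDeriv_one, deriv_ofReal hφ.differentiable,
      deriv_ofReal hφ.deriv.differentiable, integral_f] at hφ'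
    have hcomm (x : ℝ) : (φ x : ℂ) * (μ.density z x * u x) = μ.density z x * (u x * φ x) := by
      ring
    simp only [mul_comm (u _) (deriv _ _ : ℝ)] at hφ'
    simp only [Complex.real_smul, hcomm]
    rw [integral_density]
    linear_combination -hφ'
  · simp only [← Complex.real_smul, mul_comm (u _)]
    exact (hφ.integrable_smul hu.locallyIntegrable).integrableOn

theorem WeakEquation.exists_isQuasiSolutionOn {z : ℂ} {u f : ℝ → ℂ} (hu : Continuous u)
    (hf : f =ᵐ[volume] fun x => z * u x) (h : μ.WeakEquation u f) :
    ∃ w, IsQuasiSolutionOn μ.dominating (μ.density z) univ u w := by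
  obtain ⟨w, hw, hu_sub, hw_sub⟩ := exists_eq_integral_of_forall_integral_deriv_deriv_smul_eq
    ((μ.locallyIntegrable_density z).mul_continuous hu) hu
    fun φ hφ => h.integral_deriv_deriv_smul_eq hu hf hφ
  exact ⟨w, fun s t => intervalIntegrable_of_locallyIntegrable hw s t, hu_sub,
    fun s _ t _ => hw_sub s t⟩

theorem WeakEquation.eq_zero_of_frequently_agreesOn {z : ℂ} {u f : ℝ → ℂ} (hu : Continuous u)
    (hu_sq : Integrable fun x => ‖u x‖ ^ 2) (hf : f =ᵐ[volume] fun x => z * u x)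
    (h : μ.WeakEquation u f) {ι : Type*} {l : Filter ι} {p : ι → ℝ} {N : ℝ} (hN : 0 ≤ N)
    (hp : Tendsto p l atTop)
    (hper : ∃ᶠ n in l, μ.AgreesOn (μ.translate (p n)) (Ioo (-p n + N) (p n - N))) (x : ℝ) :
    u x = 0 := by
  obtain ⟨w, hw⟩ := h.exists_isQuasiSolutionOn hu hf
  refine hw.eq_zero_of_frequently_hasPeriodOn (L := N + 1) (μ.locallyIntegrable_density z)
    (by positivity) hp (hper.mono fun n hn => ?_) hu_sq x
  exact (hn.hasPeriodOn ordConnected_Ioo z).mono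
    (Icc_subset_Ioo (by linarith) (by linarith))

theorem pointSpectrum_schrodinger_eq_empty {ι : Type*} {l : Filter ι} {p : ι → ℝ} {N : ℝ}
    (hN : 0 ≤ N) (hp : Tendsto p l atTop)
    (hper : ∃ᶠ n in l, μ.AgreesOn (μ.translate (p n)) (Ioo (-p n + N) (p n - N))) :
    μ.schrodinger.pointSpectrum = ∅ := by
  rw [eq_empty_iff_forall_notMem]
  rintro z ⟨u, hu_ne, hu_eigen⟩
  have hgraph := μ.schrodinger.mem_graph u
  rw [schrodinger_graph] at hgraph
  obtain ⟨v, hv, huv, hweak⟩ := hgraph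
  have hf : (μ.schrodinger u : ℝ → ℂ) =ᵐ[volume] fun x => z * v x := by
    rw [hu_eigen]
    filter_upwards [Lp.coeFn_smul z (u : Lp ℂ 2 (volume : Measure ℝ)), huv] with x hx hx'
    rw [hx, Pi.smul_apply, smul_eq_mul, hx']
  have hv_sq : Integrable fun x => ‖v x‖ ^ 2 :=
    (memLp_two_iff_integrable_sq_norm hv.aestronglyMeasurable).1
      ((memLp_congr_ae huv).1 (Lp.memLp _))
  refine hu_ne (Subtype.ext ?_)
  rw [Submodule.coe_zero, Lp.eq_zero_iff_ae_eq_zero]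
  filter_upwards [huv] with x hx
  rw [hx, hweak.eq_zero_of_frequently_agreesOn hv hv_sq hf hN hp hper x, Pi.zero_apply]

end LocalMeasure

theorem limsup_measure_le_measure_limsup {X : Type*} [MeasurableSpace X] (P : Measure X)
    [IsFiniteMeasure P] {s : ℕ → Set X} (hs : ∀ n, NullMeasurableSet (s n) P) :
    limsup (fun n => P (s n)) atTop ≤ P (limsup s atTop) := by
  have hanti : Antitone fun k => ⋃ n ≥ k, s n := fun i j hij =>
    iUnion_mono fun n => iUnion_mono' fun h => ⟨hij.trans h, subset_rfl⟩
  simp only [limsup_eq_iInf_iSup_of_nat, iInf_eq_iInter, iSup_eq_iUnion]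
  rw [hanti.measure_iInter (fun _ => .iUnion fun n => .iUnion fun _ => hs n)
    ⟨0, measure_ne_top _ _⟩]
  exact iInf_mono fun k => iSup₂_le fun n hn =>
    measure_mono (subset_iUnion₂_of_subset n hn subset_rfl)

namespace LocalMeasure

/-- The local measures that repeat themselves three times with period `p`, up to boundary terms of
length `N`. The intervals are open in order to make this set closed in the vague topology. -/
def repeatingSet (p N : ℝ) : Set LocalMeasure :=
  {μ | μ.AgreesOn (μ.translate p) (Ioo (-p + N) (p - N))}

theorem isClosed_repeatingSet (p N : ℝ) : IsClosed (repeatingSet p N) :=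
  isClosed_setOf_agreesOn_translate p isOpen_Ioo

theorem gordonSet_subset_repeatingSet (p : ℝ) : gordonSet p ⊆ repeatingSet p 0 := fun μ hμ => by
  simpa only [repeatingSet, mem_ofPred_eq, add_zero, sub_zero] using
    agreesOn_translate_of_mem_gordonSet hμ

theorem translate_mem_repeatingSet {μ : LocalMeasure} {p N N' t : ℝ} (h : μ ∈ repeatingSet p N)
    (ht : N + |t| ≤ N') : μ.translate t ∈ repeatingSet p N' := by
  have h' := AgreesOn.translate h t
  rw [translate_translate, add_comm, ← translate_translate] at h'
  refine h'.mono fun x hx => ?_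
  constructor <;> linarith [hx.1, hx.2, neg_abs_le t, le_abs_self t]

/-- The local measures that repeat themselves three times for infinitely many of the periods `p n`,
up to boundary terms of bounded length. Allowing for the latter makes the set translation
invariant. -/
def asymptoticallyPeriodic (p : ℕ → ℝ) : Set LocalMeasure :=
  ⋃ N : ℕ, limsup (fun n => repeatingSet (p n) N) atTop

theorem mem_asymptoticallyPeriodic_iff {p : ℕ → ℝ} {μ : LocalMeasure} :
    μ ∈ asymptoticallyPeriodic p ↔ ∃ N : ℕ, ∃ᶠ n in atTop, μ ∈ repeatingSet (p n) N := by
  simp only [asymptoticallyPeriodic, mem_iUnion, mem_limsup_iff_frequently_mem]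

theorem measurableSet_asymptoticallyPeriodic (p : ℕ → ℝ) :
    MeasurableSet (asymptoticallyPeriodic p) :=
  .iUnion fun N => MeasurableSet.measurableSet_limsup fun n =>
    (isClosed_repeatingSet (p n) N).measurableSet

theorem translate_mem_asymptoticallyPeriodic {p : ℕ → ℝ} {μ : LocalMeasure}
    (h : μ ∈ asymptoticallyPeriodic p) (t : ℝ) : μ.translate t ∈ asymptoticallyPeriodic p := by
  obtain ⟨N, hN⟩ := mem_asymptoticallyPeriodic_iff.1 h
  refine mem_asymptoticallyPeriodic_iff.2 ⟨N + ⌈|t|⌉₊, hN.mono fun n hn =>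
    translate_mem_repeatingSet hn ?_⟩
  rw [Nat.cast_add]
  gcongr
  exact Nat.le_ceil _

theorem translate_mem_asymptoticallyPeriodic_iff {p : ℕ → ℝ} {μ : LocalMeasure} (t : ℝ) :
    μ.translate t ∈ asymptoticallyPeriodic p ↔ μ ∈ asymptoticallyPeriodic p := by
  refine ⟨fun h => ?_, fun h => translate_mem_asymptoticallyPeriodic h t⟩
  have h' := translate_mem_asymptoticallyPeriodic h (-t)
  rwa [translate_translate, add_neg_cancel, translate_zero] at h'

theorem limsup_measure_gordonSet_le_measure_asymptoticallyPeriodic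
    (P : Measure LocalMeasure) [IsFiniteMeasure P] (p : ℕ → ℝ) :
    limsup (fun n => P (gordonSet (p n))) atTop ≤ P (asymptoticallyPeriodic p) := by
  calc limsup (fun n => P (gordonSet (p n))) atTop
      ≤ limsup (fun n => P (repeatingSet (p n) 0)) atTop :=
        limsup_le_limsup (.of_forall fun n => measure_mono (gordonSet_subset_repeatingSet (p n)))
    _ ≤ P (limsup (fun n => repeatingSet (p n) 0) atTop) :=
        limsup_measure_le_measure_limsup P fun n =>
          (isClosed_repeatingSet (p n) 0).measurableSet.nullMeasurableSet
    _ ≤ P (asymptoticallyPeriodic p) := measure_mono <|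
        subset_iUnion_of_subset 0 (by rw [Nat.cast_zero])

end LocalMeasure

theorem mainTheorem2_general {X : Type*} [MeasurableSpace X] {P : Measure X}
    [IsProbabilityMeasure P] {T : ℝ → X → X}
    (zero_one : ∀ A, MeasurableSet A → (∀ t, T t ⁻¹' A = A) → P A = 0 ∨ P A = 1)
    {V : X → LocalMeasure} (hV : Measurable V) (hVT : ∀ t x, V (T t x) = (V x).translate t)
    {p : ℕ → ℝ} (hp : Tendsto p atTop atTop)
    (hpos : 0 < limsup (fun n => P (V ⁻¹' LocalMeasure.gordonSet (p n))) atTop) :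
    ∀ᵐ x ∂P, (V x).schrodinger.pointSpectrum = ∅ := by
  have hmeas : MeasurableSet (V ⁻¹' LocalMeasure.asymptoticallyPeriodic p) :=
    hV (LocalMeasure.measurableSet_asymptoticallyPeriodic p)
  have hinv (t : ℝ) : T t ⁻¹' (V ⁻¹' LocalMeasure.asymptoticallyPeriodic p)
      = V ⁻¹' LocalMeasure.asymptoticallyPeriodic p := by
    ext x
    simp only [mem_preimage, hVT, LocalMeasure.translate_mem_asymptoticallyPeriodic_iff]
  have hne_zero : P (V ⁻¹' LocalMeasure.asymptoticallyPeriodic p) ≠ 0 := by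
    refine (hpos.trans_le ?_).ne'
    rw [← Measure.map_apply hV (LocalMeasure.measurableSet_asymptoticallyPeriodic p)]
    exact (limsup_le_limsup (.of_forall fun _ => Measure.le_map_apply hV.aemeasurable _)).trans
      (LocalMeasure.limsup_measure_gordonSet_le_measure_asymptoticallyPeriodic (P.map V) p)
  have hae : ∀ᵐ x ∂P, V x ∈ LocalMeasure.asymptoticallyPeriodic p :=
    (prob_compl_eq_zero_iff hmeas).2 ((zero_one _ hmeas hinv).resolve_left hne_zero)
  filter_upwards [hae] with x hx
  obtain ⟨N, hN⟩ := LocalMeasure.mem_asymptoticallyPeriodic_iff.1 hx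
  exact LocalMeasure.pointSpectrum_schrodinger_eq_empty N.cast_nonneg hp hN

theorem mainTheorem2 (Ω : Set LocalMeasure) (hΩ : IsPotentialSpace Ω) (P : MeasureTheory.Measure Ω)
    (hP : hΩ.IsErgodic P) (hK : hΩ.ConditionK P) :
    ∀ᵐ ω : Ω ∂P, ω.1.schrodinger.pointSpectrum = ∅ := by
  obtain ⟨p, _, hp, hpos⟩ := hK
  have := hP.isProbabilityMeasure
  exact mainTheorem2_general hP.zero_one measurable_subtype_coe (fun _ _ => rfl) hp hpos
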